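/- Let $X_1, X_2, \dots$ be i.i.d. real random variables whose common distribution has a density, and let $F$ be their distribution function. For $n \ge 1$ consider the path with vertices $v_0, v_1, v_2, \dots$ and edges $\{v_i, v_{i+1}\}$. Give $v_i$ the height $X_i$ for $1 \le i \le n$ and the height $\infty$ otherwise, and let $K_n(t)$, $t \in \mathbb{R}$, be the subcomplex of all simplices whose vertices have height at most $t$. The $0$-dimensional persistent homology of the filtration $(K_n(t))_{t\in\mathbb{R}}$ with coefficients in $\mathbb{Z}/2$ is a direct sum of interval modules $I(b,d)$ (equal to $\mathbb{Z}/2$ for $b \le t < d$ and $0$ otherwise) over a finite multiset (the persistence diagram) of points $(b,d)$ of $$\Delta = \{(x,y) \in [-\infty,\infty]^2 : -\infty < x < y \le \infty\}.$$ Let $\xi_{0,n}$ be the sum of the unit point masses at the points of this diagram, counted with multiplicity. Then there is a unique probability measure $\xi_0$ on $\Delta$ such that, almost surely, the random probability measures $\xi_{0,n}/\xi_{0,n}(\Delta)$ converge weakly to $\xi_0$ as $n \to \infty$. With $\Delta_\ell = \{(x,y)\in\Delta : y - x > \ell\}$, it satisfies, for every $\ell \ge 0$, $$\xi_0(\Delta_\ell)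 = 3\,\mathbb{E}\left[\left(\frac{1-F(X+\ell)}{1-F(X+\ell)+F(X)}\right)^2\right], \qquad X \overset{d}{=} X_1.$$ In particular, if $X_1$ is uniformly distributed on $[0,1]$, then $\xi_0(\Delta_\ell) = 1-\ell$ for all $0 \le \ell \le 1$, so that the limiting persistence lifetimes are uniformly distributed on $[0,1]$. -/

import Mathlib

open MeasureTheory ProbabilityTheory Filter Topology

noncomputable section

/-! ### Persistence modules over `ℤ/2`, indexed by the real line -/

/-- A persistence module: a family of `ℤ/2`-vector spaces indexed by `ℝ` with compatible
linear maps. -/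
structure PersistenceModule where
  V : ℝ → Type
  [instAdd : ∀ t, AddCommGroup (V t)]
  [instMod : ∀ t, Module (ZMod 2) (V t)]
  map : ∀ {s t : ℝ}, s ≤ t → V s →ₗ[ZMod 2] V t
  map_refl : ∀ (t : ℝ) (x : V t), map (le_refl t) x = x
  map_trans : ∀ {r s t : ℝ} (h₁ : r ≤ s) (h₂ : s ≤ t) (x : V r),
    map h₂ (map h₁ x) = map (h₁.trans h₂) x

attribute [instance] PersistenceModule.instAdd PersistenceModule.instMod

namespace PersistenceModule

/-- Isomorphism of persistence modules: a family of linear isomorphisms that commutes with the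
structure maps. -/
def Isomorphic (M N : PersistenceModule) : Prop :=
  ∃ e : ∀ t : ℝ, M.V t ≃ₗ[ZMod 2] N.V t,
    ∀ {s t : ℝ} (h : s ≤ t) (x : M.V s), e t (M.map h x) = N.map h (e s x)

/-- The direct sum of finitely many persistence modules. -/
def directSum {m : ℕ} (M : Fin m → PersistenceModule) : PersistenceModule where
  V t := ∀ i, (M i).V t
  map h := LinearMap.pi fun i => (M i).map h ∘ₗ LinearMap.proj i
  map_refl t x := by
    funext i
    simp [(M i).map_refl]
  map_trans h₁ h₂ x := by
    funext i
    simp [(M i).map_trans]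

end PersistenceModule

/-- The set `Δ = {(b, d) : -∞ < b < d ≤ ∞}` of possible birth-death pairs, with the topology
and the Borel sets that it inherits from the square of the extended real line. -/
abbrev BirthDeath : Type := {p : EReal × EReal // ⊥ < p.1 ∧ p.1 < p.2}

/-- The set `Δ_ℓ` of birth-death pairs with lifetime larger than `ℓ`. -/
def lifetimeGT (ℓ : ℝ) : Set BirthDeath := {p | (ℓ : EReal) < p.1.2 - p.1.1}

open Classical in
/-- The value at `t` of the interval module `I(b, d)`: the line `ℤ/2` if `b ≤ t < d`, and the zero
space otherwise (both written as subspaces of `ℤ/2`). -/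
def intervalSpace (p : BirthDeath) (t : ℝ) : Submodule (ZMod 2) (ZMod 2) :=
  if p.1.1 ≤ (t : EReal) ∧ (t : EReal) < p.1.2 then ⊤ else ⊥

open Classical in
/-- The structure map of the interval module `I(b, d)`: the identity of `ℤ/2` if
`b ≤ s ≤ t < d`, and zero otherwise. -/
def intervalMap (p : BirthDeath) (s t : ℝ) :
    intervalSpace p s →ₗ[ZMod 2] intervalSpace p t :=
  if h : p.1.1 ≤ (s : EReal) ∧ s ≤ t ∧ (t : EReal) < p.1.2 then
    Submodule.inclusion (by
      have h' : p.1.1 ≤ (t : EReal) := h.1.trans (EReal.coe_le_coe_iff.2 h.2.1)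
      have ht : intervalSpace p t = ⊤ := if_pos ⟨h', h.2.2⟩
      rw [ht]
      exact le_top)
  else 0

/-- The interval module `I(b, d)`. -/
def intervalModule (p : BirthDeath) : PersistenceModule where
  V t := intervalSpace p t
  map {s t} _ := intervalMap p s t
  map_refl t x := by
    by_cases h : p.1.1 ≤ (t : EReal) ∧ (t : EReal) < p.1.2
    · have h' : p.1.1 ≤ (t : EReal) ∧ t ≤ t ∧ (t : EReal) < p.1.2 := ⟨h.1, le_rfl, h.2⟩
      ext
      simp [intervalMap, h']
    · have hx : (x : ZMod 2) = 0 := by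
        have := x.2
        simpa [intervalSpace, h] using this
      have hx' : x = 0 := Subtype.ext hx
      simp [hx']
  map_trans {r s t} h₁ h₂ x := by
    by_cases h : p.1.1 ≤ (r : EReal) ∧ (t : EReal) < p.1.2
    · have hs : (s : EReal) < p.1.2 := lt_of_le_of_lt (EReal.coe_le_coe_iff.2 h₂) h.2
      have hs' : p.1.1 ≤ (s : EReal) := h.1.trans (EReal.coe_le_coe_iff.2 h₁)
      ext
      simp [intervalMap, h.1, h.2, hs, hs', h₁, h₂, h₁.trans h₂]
    · have hz : intervalMap p r t = 0 := by
        rw [intervalMap, dif_neg]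
        exact fun hh => h ⟨hh.1, hh.2.2⟩
      rw [hz]
      by_cases hr : p.1.1 ≤ (r : EReal)
      · have ht : ¬ (t : EReal) < p.1.2 := fun ht => h ⟨hr, ht⟩
        simp [intervalMap, ht]
      · simp [intervalMap, hr]

/-! ### Sublevel set filtrations of the infinite path -/

/-- The one-dimensional simplicial complex with vertices `0, 1, 2, …` and edges `{i, i + 1}`. -/
def pathComplex : Set (Finset ℕ) := {σ | ∃ i : ℕ, σ = {i} ∨ σ = {i, i + 1}}

/-- The sublevel complex at level `t` of the vertex heights `x`: the simplices on which the
maximal height is at most `t`. -/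
def sublevel (x : ℕ → EReal) (t : ℝ) : Set (Finset ℕ) :=
  {σ | σ ∈ pathComplex ∧ ∀ v ∈ σ, x v ≤ (t : EReal)}

/-- A vertex belongs to the sublevel complex exactly if its height is at most `t`. -/
lemma singleton_mem_sublevel (x : ℕ → EReal) (t : ℝ) (i : ℕ) :
    ({i} : Finset ℕ) ∈ sublevel x t ↔ x i ≤ (t : EReal) := by
  constructor
  · exact fun h => h.2 i (by simp)
  · intro h
    exact ⟨⟨i, Or.inl rfl⟩, fun v hv => by rwa [Finset.mem_singleton.1 hv]⟩

/-- The 0-chains of the sublevel complex with coefficients in `ℤ/2`. -/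
abbrev Chains₀ (x : ℕ → EReal) (t : ℝ) : Type :=
  {i : ℕ // ({i} : Finset ℕ) ∈ sublevel x t} →₀ ZMod 2

/-- The 1-chains of the sublevel complex with coefficients in `ℤ/2`; the basis vector with
index `i` stands for the edge `{i, i + 1}`. -/
abbrev Chains₁ (x : ℕ → EReal) (t : ℝ) : Type :=
  {i : ℕ // ({i, i + 1} : Finset ℕ) ∈ sublevel x t} →₀ ZMod 2

/-- The lower end point of an edge of the sublevel complex. -/
def edgeLower {x : ℕ → EReal} {t : ℝ} (i : {i : ℕ // ({i, i + 1} : Finset ℕ) ∈ sublevel x t}) :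
    {i : ℕ // ({i} : Finset ℕ) ∈ sublevel x t} :=
  ⟨i.1, (singleton_mem_sublevel x t _).2 (i.2.2 _ (by simp))⟩

/-- The upper end point of an edge of the sublevel complex. -/
def edgeUpper {x : ℕ → EReal} {t : ℝ} (i : {i : ℕ // ({i, i + 1} : Finset ℕ) ∈ sublevel x t}) :
    {i : ℕ // ({i} : Finset ℕ) ∈ sublevel x t} :=
  ⟨i.1 + 1, (singleton_mem_sublevel x t _).2 (i.2.2 _ (by simp))⟩

/-- The boundary map `∂₁`, which sends the edge `{i, i + 1}` to the sum of its end points. -/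
def boundary (x : ℕ → EReal) (t : ℝ) : Chains₁ x t →ₗ[ZMod 2] Chains₀ x t :=
  Finsupp.lmapDomain (ZMod 2) (ZMod 2) edgeLower + Finsupp.lmapDomain (ZMod 2) (ZMod 2) edgeUpper

/-- The boundaries `B₀ = ∂₁(C₁)`. -/
def boundaries₀ (x : ℕ → EReal) (t : ℝ) : Submodule (ZMod 2) (Chains₀ x t) :=
  LinearMap.range (boundary x t)

lemma sublevel_mono (x : ℕ → EReal) {s t : ℝ} (h : s ≤ t) : sublevel x s ⊆ sublevel x t :=
  fun _ hσ => ⟨hσ.1, fun v hv => (hσ.2 v hv).trans (EReal.coe_le_coe_iff.2 h)⟩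

/-- The map of 0-chains that is induced by the inclusion of sublevel complexes. -/
def chainsInclusion (x : ℕ → EReal) {s t : ℝ} (h : s ≤ t) : Chains₀ x s →ₗ[ZMod 2] Chains₀ x t :=
  Finsupp.lmapDomain (ZMod 2) (ZMod 2) fun i => ⟨i.1, sublevel_mono x h i.2⟩

lemma boundaries₀_le_comap (x : ℕ → EReal) {s t : ℝ} (h : s ≤ t) :
    boundaries₀ x s ≤ (boundaries₀ x t).comap (chainsInclusion x h) := by
  rintro _ ⟨c, rfl⟩
  refine ⟨Finsupp.lmapDomain (ZMod 2) (ZMod 2) (fun i => ⟨i.1, sublevel_mono x h i.2⟩) c, ?_⟩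
  simp only [boundary, chainsInclusion, LinearMap.add_apply, Finsupp.lmapDomain_apply, map_add,
    ← Finsupp.mapDomain_comp]
  rfl

/-- The 0-dimensional persistent homology of the sublevel set filtration of `x`: the spaces
`H₀ = Z₀ / B₀`, where all 0-chains are cycles, with the maps that are induced by the inclusions. -/
def persistentHomology₀ (x : ℕ → EReal) : PersistenceModule where
  V t := Chains₀ x t ⧸ boundaries₀ x t
  map {s t} h := (boundaries₀ x s).mapQ (boundaries₀ x t)
    (chainsInclusion x h) (boundaries₀_le_comap x h)
  map_refl t y := by
    induction y using Submodule.Quotient.induction_on with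
    | _ c =>
      rw [Submodule.mapQ_apply]
      congr 1
      exact Finsupp.mapDomain_id
  map_trans h₁ h₂ y := by
    induction y using Submodule.Quotient.induction_on with
    | _ c =>
      rw [Submodule.mapQ_apply, Submodule.mapQ_apply, Submodule.mapQ_apply]
      congr 1
      exact Finsupp.mapDomain_comp.symm

/-! ### Persistence diagrams -/

/-- The multiset `D` is a persistence diagram of `M`: `M` is isomorphic to the direct sum of the
interval modules `I(b, d)` over the points `(b, d)` of `D`, counted with multiplicity. -/
def IsPersistenceDiagram (M : PersistenceModule) (D : Multiset BirthDeath) : Prop :=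
  ∃ (m : ℕ) (p : Fin m → BirthDeath), D = Multiset.map p Finset.univ.val ∧
    M.Isomorphic (PersistenceModule.directSum fun i => intervalModule (p i))

open Classical in
/-- The persistence diagram of `M`. (It is empty if `M` has no finite decomposition into interval
modules, which does not happen for the filtrations considered here.) -/
def persistenceDiagram (M : PersistenceModule) : Multiset BirthDeath :=
  if h : ∃ D, IsPersistenceDiagram M D then h.choose else 0

/-- The heights on the path that belong to the first `n` terms of a real sequence: with
`X₁ = a 0, X₂ = a 1, …`, vertex `ℤ/2` has height `X_k` for `1 ≤ k ≤ n`, and all other vertices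
(vertex `0` included) have height `∞`. -/
def truncatedHeights (a : ℕ → ℝ) (n : ℕ) : ℕ → EReal
  | 0 => ⊤
  | k + 1 => if k < n then (a k : EReal) else ⊤

/-- The measure `ξ_{0,n}` on `Δ`: the sum of the unit point masses at the points (with multiplicity)
of the 0-dimensional sublevel set persistence diagram of the first `n` terms of `a`. -/
def diagramMeasure (a : ℕ → ℝ) (n : ℕ) : Measure BirthDeath :=
  ((persistenceDiagram (persistentHomology₀ (truncatedHeights a n))).map Measure.dirac).sum

/-- The normalization `ξ_{0,n} / ξ_{0,n}(Δ)`. -/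
def normalizedDiagramMeasure (a : ℕ → ℝ) (n : ℕ) : Measure BirthDeath :=
  (diagramMeasure a n Set.univ)⁻¹ • diagramMeasure a n

/-- Almost surely, the random probability measures `ξ_{0,n} / ξ_{0,n}(Δ)` of the sequence `X`
converge weakly to `ξ₀` as `n → ∞`. -/
def IsLimitDiagramMeasure {Ω : Type*} [MeasurableSpace Ω] (P : Measure Ω) (X : ℕ → Ω → ℝ)
    (ξ₀ : ProbabilityMeasure BirthDeath) : Prop :=
  ∀ᵐ ω ∂P, ∀ g : BoundedContinuousFunction BirthDeath ℝ,
    Tendsto (fun n : ℕ => ∫ z, g z ∂(normalizedDiagramMeasure (fun k => X k ω) n)) atTop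
      (𝓝 (∫ z, g z ∂(ξ₀ : Measure BirthDeath)))

end

open MeasureTheory ProbabilityTheory Filter Topology

noncomputable section

/-! ### The elder rule for a path -/

/-! The diagram is explicit by the elder rule. A vertex `v` gives birth to a component at its own
height, and this component dies at the lowest level at which `v` is connected to a lower vertex `w
v`. The differences `[v] - [w v]` generate interval modules whose sum is `H₀`
(`isomorphic_directSum`). The choice made in `persistenceDiagram` is harmless, because the images of
the structure maps determine the number of points in every quadrant {birth ≤ s, death > t} with s ≤
t, and these numbers determine the measure.

For s ≤ t the points in a quadrant are thus the terms `X_k ≤ s` from which no lower term can be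
reached without rising above t. Walk from such a term, of height x, to the left and to the right
until [x, t] is left. The point is present exactly if both exits are upwards. Given x, the two walks
are independent and each exits upwards with probability (1 - F(t)) / (1 - F(t) + F(x)), so the
density of such terms is the integral of the square of this ratio over x ≤ s. All points together
correspond, up to the two end terms, to the local minima, whose density is ∫ (1 - F)² dF = 1/3; this
explains the factor 3.

The walks are unbounded, while the law of large numbers handles patterns of fixed finite length only
(`ae_tendsto_pattern_frequency`). Finite exit patterns bound both the surviving and the dying terms
from below. Their probabilities add up to that of `X ≤ s`, so no mass is lost and both counts
converge (`tendsto_of_sum_le`, `ae_tendsto_quadrant_count`).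

Differentiating the squared ratio in the death level gives the density of the limit with respect to
μ ⊗ μ (`deathDensity`). Convergence on countably many rational quadrants passes to rectangles and
hence to weak convergence (`tendsto_of_tendsto_quadrant`). -/

/-- All heights between `i` and `j` are at most `t`. -/
def PathConnected (x : ℕ → EReal) (t : EReal) (i j : ℕ) : Prop :=
  ∀ k ∈ Finset.uIcc i j, x k ≤ t

namespace PathConnected

variable {x : ℕ → EReal} {s t : EReal} {i j k : ℕ}

lemma left (h : PathConnected x t i j) : x i ≤ t := h i Finset.left_mem_uIcc

lemma right (h : PathConnected x t i j) : x j ≤ t := h j Finset.right_mem_uIcc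

lemma refl (h : x i ≤ t) : PathConnected x t i i := by
  intro k hk
  simp only [Finset.uIcc_self, Finset.mem_singleton] at hk
  rwa [hk]

lemma symm (h : PathConnected x t i j) : PathConnected x t j i := by
  intro k hk
  rw [Finset.uIcc_comm] at hk
  exact h k hk

lemma trans (h : PathConnected x t i j) (h' : PathConnected x t j k) : PathConnected x t i k := by
  intro l hl
  rcases Finset.mem_union.1 (Finset.uIcc_subset_uIcc_union_uIcc (b := j) hl) with hl | hl
  · exact h l hl
  · exact h' l hl

lemma mono (h : PathConnected x s i j) (hst : s ≤ t) : PathConnected x t i j :=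
  fun k hk => (h k hk).trans hst

lemma iff_sup_le : PathConnected x t i j ↔ (Finset.uIcc i j).sup x ≤ t :=
  Finset.sup_le_iff.symm

lemma succ (h : x i ≤ t) (h' : x (i + 1) ≤ t) : PathConnected x t i (i + 1) := by
  intro k hk
  rw [Finset.uIcc_of_le (Nat.le_succ i), Finset.mem_Icc] at hk
  obtain rfl | rfl : k = i ∨ k = i + 1 := by omega
  · exact h
  · exact h'

end PathConnected

/-- The class in `H₀` of the vertex `i`, or zero if it is not in the sublevel complex. -/
def vertexClass (x : ℕ → EReal) (t : ℝ) (i : ℕ) : Chains₀ x t ⧸ boundaries₀ x t :=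
  open Classical in
  if h : ({i} : Finset ℕ) ∈ sublevel x t then
    Submodule.Quotient.mk (Finsupp.single ⟨i, h⟩ 1) else 0

lemma vertexClass_of_le {x : ℕ → EReal} {t : ℝ} {i : ℕ} (h : ({i} : Finset ℕ) ∈ sublevel x t) :
    vertexClass x t i = Submodule.Quotient.mk (Finsupp.single ⟨i, h⟩ 1) := dif_pos h

lemma vertexClass_of_lt {x : ℕ → EReal} {t : ℝ} {i : ℕ} (h : (t : EReal) < x i) :
    vertexClass x t i = 0 :=
  dif_neg fun h' => absurd ((singleton_mem_sublevel x t i).1 h') (not_le.2 h)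

lemma map_vertexClass {x : ℕ → EReal} {s t : ℝ} (h : s ≤ t) {i : ℕ} (hi : x i ≤ s) :
    (persistentHomology₀ x).map h (vertexClass x s i) = vertexClass x t i := by
  have hs := (singleton_mem_sublevel x s i).2 hi
  rw [vertexClass_of_le hs, vertexClass_of_le (sublevel_mono x h hs)]
  change Submodule.Quotient.mk (chainsInclusion x h (Finsupp.single ⟨i, hs⟩ 1)) = _
  congr 1
  exact Finsupp.mapDomain_single

lemma vertexClass_succ {x : ℕ → EReal} {t : ℝ} {i : ℕ} (hi : x i ≤ t) (hi' : x (i + 1) ≤ t) :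
    vertexClass x t i = vertexClass x t (i + 1) := by
  have he : ({i, i + 1} : Finset ℕ) ∈ sublevel x t := by
    refine ⟨⟨i, Or.inr rfl⟩, fun v hv => ?_⟩
    rcases Finset.mem_insert.1 hv with rfl | hv
    · exact hi
    · rwa [Finset.mem_singleton.1 hv]
  rw [vertexClass_of_le ((singleton_mem_sublevel x t i).2 hi),
    vertexClass_of_le ((singleton_mem_sublevel x t (i + 1)).2 hi'), Submodule.Quotient.eq]
  refine ⟨Finsupp.single ⟨i, he⟩ 1, ?_⟩
  -- In characteristic 2 the difference of the end points is their sum, which is the boundary of the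
  -- edge.
  have h2 (c : Chains₀ x t) : -c = c := by
    ext j
    simp [ZMod.neg_eq_self_mod_two]
  rw [sub_eq_add_neg, h2]
  simp only [boundary, LinearMap.add_apply, Finsupp.lmapDomain_apply, Finsupp.mapDomain_single]
  rfl

lemma PathConnected.vertexClass_eq {x : ℕ → EReal} {t : ℝ} {i j : ℕ}
    (h : PathConnected x t i j) : vertexClass x t i = vertexClass x t j := by
  wlog hij : i ≤ j generalizing i j
  · exact (this h.symm (by omega)).symm
  obtain ⟨k, rfl⟩ := Nat.exists_eq_add_of_le hij
  have hk : ∀ l ≤ k, x (i + l) ≤ t := fun l hl => h _ (by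
    rw [Finset.uIcc_of_le hij, Finset.mem_Icc]
    omega)
  clear h hij
  induction k with
  | zero => rfl
  | succ k ih =>
    rw [ih fun l hl => hk l (by omega)]
    exact vertexClass_succ (hk k (by omega)) (hk (k + 1) le_rfl)

lemma span_vertexClass (x : ℕ → EReal) (t : ℝ) :
    Submodule.span (ZMod 2) (vertexClass x t '' {i | x i ≤ t}) = ⊤ := by
  rw [eq_top_iff]
  rintro y -
  induction y using Submodule.Quotient.induction_on with
  | _ c =>
    induction c using Finsupp.induction_linear with
    | zero => exact Submodule.zero_mem _
    | add f g hf hg => exact Submodule.add_mem _ hf hg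
    | single i a =>
      rw [← mul_one a, ← smul_eq_mul, ← Finsupp.smul_single, Submodule.Quotient.mk_smul]
      refine Submodule.smul_mem _ _ (Submodule.subset_span ⟨i.1, ?_, vertexClass_of_le i.2⟩)
      exact (singleton_mem_sublevel x t i.1).1 i.2

open Classical in
/-- The functional on `H₀` that detects the component of `v`. -/
def componentFunctional (x : ℕ → EReal) (t : ℝ) (v : ℕ) :
    (Chains₀ x t ⧸ boundaries₀ x t) →ₗ[ZMod 2] ZMod 2 :=
  (boundaries₀ x t).liftQ
    (Finsupp.lsum (ZMod 2) fun i => if PathConnected x t v i.1 then LinearMap.id else 0) (by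
      rintro _ ⟨c, rfl⟩
      rw [LinearMap.mem_ker]
      induction c using Finsupp.induction_linear with
      | zero => simp
      | add f g hf hg => rw [map_add, map_add, hf, hg, add_zero]
      | single i a =>
        have hl := (singleton_mem_sublevel x t _).1 (edgeLower i).2
        have hu := (singleton_mem_sublevel x t _).1 (edgeUpper i).2
        -- The component of `v` contains both end points of an edge or neither, so the boundary is
        -- counted twice or not at all.
        have hc : PathConnected x t v (edgeLower i).1 ↔ PathConnected x t v (edgeUpper i).1 :=
          ⟨fun h => h.trans (.succ hl hu), fun h => h.trans (PathConnected.succ hl hu).symm⟩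
        simp only [boundary, LinearMap.add_apply, Finsupp.lmapDomain_apply,
          Finsupp.mapDomain_single, map_add, Finsupp.lsum_single, hc]
        exact CharTwo.add_self_eq_zero _)

open Classical in
lemma componentFunctional_vertexClass {x : ℕ → EReal} {t : ℝ} {v i : ℕ} :
    componentFunctional x t v (vertexClass x t i) = if PathConnected x t v i then 1 else 0 := by
  by_cases hi : x i ≤ t
  · rw [vertexClass_of_le ((singleton_mem_sublevel x t i).2 hi)]
    refine (Submodule.liftQ_apply _ _ _).trans ?_
    rw [Finsupp.lsum_single]
    split_ifs <;> rfl
  · rw [vertexClass_of_lt (not_le.1 hi), map_zero, if_neg fun h => hi h.right]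

/-- The level at which the component that is born at the vertex `v` merges with an older one;
`S` is the set of vertices of finite height. -/
def deathLevel (x : ℕ → EReal) (S : Finset ℕ) (v : ℕ) : EReal :=
  open Classical in (S.filter (x · < x v)).inf fun w => (Finset.uIcc v w).sup x

/-- Restricting the infimum to `S` loses nothing, as a vertex lower than `v` has finite height. `t <
⊤` is needed because the infimum over no vertices is `⊤`. -/
lemma lt_deathLevel_iff {x : ℕ → EReal} {S : Finset ℕ} (hS : ∀ v, v ∈ S ↔ x v < ⊤) {v : ℕ}
    {t : EReal} (ht : t < ⊤) :
    t < deathLevel x S v ↔ ∀ w, x w < x v → ¬ PathConnected x t v w := by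
  classical
  rw [deathLevel, Finset.lt_inf_iff ht]
  simp only [Finset.mem_filter, hS, PathConnected.iff_sup_le, not_le]
  exact ⟨fun h w hw => h w ⟨hw.trans_le le_top, hw⟩, fun h w hw => h w hw.2⟩

/-- The vertex of an older component with which the component of `v` merges. -/
lemma exists_elder {x : ℕ → EReal} {S : Finset ℕ} (h0 : x 0 = ⊤) (v : ℕ) :
    ∃ w, (x w = ⊤ ∧ deathLevel x S v = ⊤) ∨
      (x w < x v ∧ PathConnected x (deathLevel x S v) v w) := by
  classical
  by_cases h : (S.filter (x · < x v)).Nonempty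
  · obtain ⟨w, hw, hw'⟩ := Finset.exists_mem_eq_inf _ h fun w => (Finset.uIcc v w).sup x
    refine ⟨w, Or.inr ⟨(Finset.mem_filter.1 hw).2, ?_⟩⟩
    rw [PathConnected.iff_sup_le]
    exact hw'.ge
  -- Without a lower vertex there is no elder; vertex 0, of height `∞`, is a dummy whose class is
  -- zero at every level.
  · refine ⟨0, Or.inl ⟨h0, ?_⟩⟩
    rw [deathLevel, Finset.not_nonempty_iff_eq_empty.1 h, Finset.inf_empty]


/-- The class of `v` minus that of an elder vertex `w` into whose component it merges. -/
def intervalGenerator (x : ℕ → EReal) (w : ℕ → ℕ) (t : ℝ) (v : ℕ) :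
    Chains₀ x t ⧸ boundaries₀ x t :=
  vertexClass x t v - vertexClass x t (w v)

/-! ### The interval decomposition of `H₀` -/

section Decomposition

variable {x : ℕ → EReal} {S : Finset ℕ} {w : ℕ → ℕ} {m : ℕ} {vs : Fin m → ℕ} {p : Fin m → BirthDeath}

/-- The map from the sum of the interval modules to homology, at level `t`. -/
def intervalSum (x : ℕ → EReal) (w : ℕ → ℕ) (vs : Fin m → ℕ) (p : Fin m → BirthDeath) (t : ℝ) :
    (∀ i, intervalSpace (p i) t) →ₗ[ZMod 2] Chains₀ x t ⧸ boundaries₀ x t :=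
  ∑ i, (LinearMap.toSpanSingleton (ZMod 2) _ (intervalGenerator x w t (vs i))) ∘ₗ
    (intervalSpace (p i) t).subtype ∘ₗ LinearMap.proj i

lemma intervalSum_apply (t : ℝ) (c : ∀ i, intervalSpace (p i) t) :
    intervalSum x w vs p t c = ∑ i, (c i : ZMod 2) • intervalGenerator x w t (vs i) := by
  simp [intervalSum, LinearMap.sum_apply]

lemma intervalSpace_coe_eq_zero {p : BirthDeath} {t : ℝ}
    (h : ¬ (p.1.1 ≤ (t : EReal) ∧ (t : EReal) < p.1.2)) (c : intervalSpace p t) :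
    (c : ZMod 2) = 0 := by
  have := c.2
  simpa [intervalSpace, h] using this

lemma intervalSpace_eq_top {p : BirthDeath} {t : ℝ}
    (h : p.1.1 ≤ (t : EReal) ∧ (t : EReal) < p.1.2) : intervalSpace p t = ⊤ := if_pos h

/-- From the death level on, `v` and `w v` are connected, so the generator vanishes just as the
interval map does. With the dummy elder the death is `⊤` and this never happens. -/
lemma intervalSum_natural (h0 : ∀ v, (x (w v) = ⊤ ∧ deathLevel x S v = ⊤) ∨
      (x (w v) < x v ∧ PathConnected x (deathLevel x S v) v (w v)))
    (hp : ∀ i, (p i).1 = (x (vs i), deathLevel x S (vs i))) {s t : ℝ} (h : s ≤ t)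
    (c : ∀ i, intervalSpace (p i) s) :
    (persistentHomology₀ x).map h (intervalSum x w vs p s c) =
      intervalSum x w vs p t fun i => intervalMap (p i) s t (c i) := by
  rw [intervalSum_apply, intervalSum_apply]
  refine (map_sum ((persistentHomology₀ x).map h) _ _).trans (Finset.sum_congr rfl fun i _ => ?_)
  refine (((persistentHomology₀ x).map h).map_smul _ _).trans ?_
  by_cases hs : (p i).1.1 ≤ (s : EReal) ∧ (s : EReal) < (p i).1.2
  swap
  · rw [intervalSpace_coe_eq_zero hs]
    have : c i = 0 := Subtype.ext (intervalSpace_coe_eq_zero hs _)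
    rw [this, map_zero]
    exact (zero_smul _ _).trans (zero_smul _ _).symm
  have hv : x (vs i) ≤ s := by simpa [hp] using hs.1
  have hmap : (persistentHomology₀ x).map h (intervalGenerator x w s (vs i)) =
      intervalGenerator x w t (vs i) := by
    refine (map_sub ((persistentHomology₀ x).map h) _ _).trans ?_
    rw [map_vertexClass h hv, intervalGenerator]
    congr 1
    rcases h0 (vs i) with hw | hw
    · rw [vertexClass_of_lt (by simp [hw.1]), vertexClass_of_lt (by simp [hw.1])]
      exact map_zero ((persistentHomology₀ x).map h)
    · exact map_vertexClass h (hw.1.le.trans hv)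
  refine (congrArg _ hmap).trans ?_
  by_cases ht : (t : EReal) < (p i).1.2
  · have : ((intervalMap (p i) s t (c i) : intervalSpace (p i) t) : ZMod 2) = c i := by
      rw [intervalMap, dif_pos ⟨hs.1, h, ht⟩]
      rfl
    rw [this]
    rfl
  · have hd : deathLevel x S (vs i) ≤ t := by simpa [hp] using ht
    have : intervalGenerator x w t (vs i) = 0 := by
      rcases h0 (vs i) with hw | hw
      · rw [hw.2] at hd
        exact absurd hd (by simp)
      · rw [intervalGenerator, (hw.2.mono hd).vertexClass_eq, sub_self]
    rw [this]
    have hz (a : ZMod 2) : a • (0 : Chains₀ x t ⧸ boundaries₀ x t) = 0 := smul_zero a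
    exact (hz _).trans (hz _).symm

/-- Induction on the number of lower vertices: `[v]` is the generator plus `[w v]` while `v` is
alive and equals `[w v]` afterwards, and `w v` is lower than `v` or has class zero. -/
lemma intervalSum_surjective (hS : ∀ v, v ∈ S ↔ x v < ⊤)
    (h0 : ∀ v, (x (w v) = ⊤ ∧ deathLevel x S v = ⊤) ∨
      (x (w v) < x v ∧ PathConnected x (deathLevel x S v) v (w v)))
    (hvs : ∀ v, x v < deathLevel x S v → ∃ i, vs i = v)
    (hp : ∀ i, (p i).1 = (x (vs i), deathLevel x S (vs i))) (t : ℝ) :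
    Function.Surjective (intervalSum x w vs p t) := by
  classical
  rw [← LinearMap.range_eq_top, eq_top_iff, ← span_vertexClass, Submodule.span_le]
  have hfin : ∀ n : ℕ, ∀ v, x v ≤ t → (S.filter (x · < x v)).card < n →
      vertexClass x t v ∈ LinearMap.range (intervalSum x w vs p t) := by
    intro n
    induction n with
    | zero => intro v _ h; omega
    | succ n ih =>
      intro v hv hn
      have hw : vertexClass x t (w v) ∈ LinearMap.range (intervalSum x w vs p t) := by
        rcases h0 v with h | h
        · rw [vertexClass_of_lt (by simp [h.1])]
          exact Submodule.zero_mem _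
        · refine ih _ (h.1.le.trans hv) (lt_of_lt_of_le (Finset.card_lt_card ?_) (Nat.lt_succ_iff.1 hn))
          rw [Finset.ssubset_iff_of_subset]
          · exact ⟨w v, by simp [hS, h.1, h.1.trans_le le_top], by simp⟩
          · intro u hu
            simp only [Finset.mem_filter] at hu ⊢
            exact ⟨hu.1, hu.2.trans h.1⟩
      by_cases hd : (t : EReal) < deathLevel x S v
      · obtain ⟨i, rfl⟩ := hvs v (hv.trans_lt hd)
        rw [← sub_add_cancel (vertexClass x t (vs i)) (vertexClass x t (w (vs i)))]
        refine Submodule.add_mem _ ?_ hw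
        have htop : intervalSpace (p i) t = ⊤ :=
          intervalSpace_eq_top ⟨by simpa [hp] using hv, by simpa [hp] using hd⟩
        refine ⟨Pi.single i ⟨1, by rw [htop]; trivial⟩, ?_⟩
        rw [intervalSum_apply, Finset.sum_eq_single i]
        · simp [intervalGenerator]
        · intro j _ hj
          simp [Pi.single_eq_of_ne hj]
        · simp
      · rcases h0 v with h | h
        · rw [h.2] at hd
          exact absurd (EReal.coe_lt_top t) hd
        · rwa [(h.2.mono (not_lt.1 hd)).vertexClass_eq]
  rintro _ ⟨v, hv, rfl⟩
  exact hfin _ v hv (Nat.lt_succ_self _)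

/-- Test a linear relation with the functional of the component of the highest vertex in its
support, unique because heights are distinct. This vertex is alive, so its component contains no
lower vertex: all other vertices of the relation and all elders are invisible to the functional. -/
lemma intervalSum_injective (hS : ∀ v, v ∈ S ↔ x v < ⊤) (hinj : Set.InjOn x S)
    (h0 : ∀ v, (x (w v) = ⊤ ∧ deathLevel x S v = ⊤) ∨
      (x (w v) < x v ∧ PathConnected x (deathLevel x S v) v (w v)))
    (hvs : Function.Injective vs)
    (hp : ∀ i, (p i).1 = (x (vs i), deathLevel x S (vs i))) (t : ℝ) :
    Function.Injective (intervalSum x w vs p t) := by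
  classical
  rw [← LinearMap.ker_eq_bot, LinearMap.ker_eq_bot']
  intro c hc
  by_contra hne
  have hex : (Finset.univ.filter fun i => (c i : ZMod 2) ≠ 0).Nonempty := by
    by_contra hempty
    rw [Finset.not_nonempty_iff_eq_empty, Finset.filter_eq_empty_iff] at hempty
    exact hne (funext fun i => Subtype.ext (not_not.1 (hempty (Finset.mem_univ i))))
  obtain ⟨i, hi, hmax⟩ := Finset.exists_max_image _ (fun i => x (vs i)) hex
  simp only [Finset.mem_filter, Finset.mem_univ, true_and] at hi hmax
  have hali : ∀ j, (c j : ZMod 2) ≠ 0 → x (vs j) ≤ t ∧ (t : EReal) < deathLevel x S (vs j) := by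
    intro j hj
    by_contra hj'
    exact hj (intervalSpace_coe_eq_zero (by simpa [hp] using hj') _)
  obtain ⟨hvi, hdi⟩ := hali i hi
  rw [lt_deathLevel_iff hS (EReal.coe_lt_top t)] at hdi
  have happ := congrArg (componentFunctional x t (vs i)) hc
  rw [intervalSum_apply, map_sum, map_zero, Finset.sum_eq_single i] at happ
  · rw [map_smul, intervalGenerator, map_sub, componentFunctional_vertexClass,
      componentFunctional_vertexClass, if_pos (PathConnected.refl hvi), if_neg] at happ
    · exact hi (by simpa using happ)
    · intro h
      rcases h0 (vs i) with h' | h'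
      · have := h.right
        simp [h'.1] at this
      · exact hdi _ h'.1 h
  · intro j _ hj
    by_cases hcj : (c j : ZMod 2) = 0
    · rw [hcj, zero_smul, map_zero]
    obtain ⟨hvj, -⟩ := hali j hcj
    have hlt : x (vs j) < x (vs i) := by
      refine lt_of_le_of_ne (hmax j hcj) fun he => hj (hvs (hinj ?_ ?_ he))
      · exact (hS _).2 (hvj.trans_lt (EReal.coe_lt_top t))
      · exact (hS _).2 (hvi.trans_lt (EReal.coe_lt_top t))
    rw [map_smul, intervalGenerator, map_sub, componentFunctional_vertexClass,
      componentFunctional_vertexClass, if_neg (hdi _ hlt), if_neg]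
    · simp
    · intro h
      rcases h0 (vs j) with h' | h'
      · have := h.right
        simp [h'.1] at this
      · exact hdi _ (h'.1.trans hlt) h
  · simp

/-- The elder rule: the points `(x v, deathLevel x S v)` form the persistence diagram. -/
theorem isomorphic_directSum (h0 : x 0 = ⊤) (hS : ∀ v, v ∈ S ↔ x v < ⊤) (hinj : Set.InjOn x S)
    (hvs : Function.Injective vs) (hvs' : ∀ v, x v < deathLevel x S v → ∃ i, vs i = v)
    (hp : ∀ i, (p i).1 = (x (vs i), deathLevel x S (vs i))) :
    (persistentHomology₀ x).Isomorphic
      (PersistenceModule.directSum fun i => intervalModule (p i)) := by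
  choose w hw using exists_elder (S := S) h0
  let e (t : ℝ) := LinearEquiv.ofBijective (intervalSum x w vs p t)
    ⟨intervalSum_injective hS hinj hw hvs hp t, intervalSum_surjective hS hw hvs' hp t⟩
  refine ⟨fun t => (e t).symm, fun {s t} h y => ?_⟩
  refine (e t).symm_apply_eq.2 ?_
  obtain ⟨c, rfl⟩ := (e s).surjective y
  refine (intervalSum_natural hw hp h c).trans ?_
  exact congrArg
    (fun z => e t ((PersistenceModule.directSum fun i => intervalModule (p i)).map h z))
    ((e s).symm_apply_apply c).symm

end Decomposition

/-! ### Uniqueness of the persistence diagram -/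

/-- The birth-death pairs that are born at or before `s` and die after `t`. -/
def quadrant (s t : EReal) : Set BirthDeath := {p | p.1.1 ≤ s ∧ t < p.1.2}

lemma mem_quadrant {s t : EReal} {p : BirthDeath} : p ∈ quadrant s t ↔ p.1.1 ≤ s ∧ t < p.1.2 :=
  Iff.rfl

lemma measurable_birth : Measurable fun p : BirthDeath => p.1.1 :=
  measurable_fst.comp measurable_subtype_coe

lemma measurable_death : Measurable fun p : BirthDeath => p.1.2 :=
  measurable_snd.comp measurable_subtype_coe

lemma measurableSet_quadrant (s t : EReal) : MeasurableSet (quadrant s t) :=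
  (measurable_birth measurableSet_Iic).inter (measurable_death measurableSet_Ioi)

lemma quadrant_inter (s t s' t' : EReal) :
    quadrant s t ∩ quadrant s' t' = quadrant (min s s') (max t t') := by
  ext p
  simp only [Set.mem_inter_iff, mem_quadrant, le_min_iff, max_lt_iff]
  tauto

lemma exists_mem_quadrant_rat (p : BirthDeath) :
    ∃ q : ℚ, p ∈ quadrant ((q : ℝ) : EReal) ((q : ℝ) : EReal) := by
  obtain ⟨q, h1, h2⟩ := EReal.lt_iff_exists_rat_btwn.1 p.2.2
  exact ⟨q, h1.le, h2⟩

/-- The Borel sets of `Δ` are generated by the quadrants. -/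
lemma birthDeath_generateFrom_quadrant :
    (inferInstance : MeasurableSpace BirthDeath) =
      MeasurableSpace.generateFrom {A | ∃ s t : ℝ, s ≤ t ∧ A = quadrant s t} := by
  set m := MeasurableSpace.generateFrom {A | ∃ s t : ℝ, s ≤ t ∧ A = quadrant s t} with hm
  have hQ {s t : ℝ} (h : s ≤ t) : MeasurableSet[m] (quadrant s t) :=
    MeasurableSpace.measurableSet_generateFrom ⟨s, t, h, rfl⟩
  apply le_antisymm
  · have h1 : Measurable[m] fun p : BirthDeath => p.1.1 := by
      refine measurable_of_Iic (mδ := m) fun s => ?_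
      induction s with
      | bot =>
        convert @MeasurableSet.empty _ m
        ext p
        simpa using p.2.1.ne'
      | top =>
        convert @MeasurableSet.univ _ m
        ext p
        simp
      | coe s =>
        -- Only quadrants with s ≤ t are available. A point born by `s` either outlives `s` or dies
        -- by `s`; in the latter case a rational between birth and death is at most `s`.
        have : (fun p : BirthDeath => p.1.1) ⁻¹' Set.Iic (s : EReal) = quadrant s s ∪
            ⋃ q : ℚ, ⋃ _ : (q : ℝ) ≤ s, quadrant ((q : ℝ) : EReal) ((q : ℝ) : EReal) := by
          ext p
          simp only [Set.mem_preimage, Set.mem_Iic, Set.mem_union, Set.mem_iUnion]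
          constructor
          · intro hp
            by_cases hd : (s : EReal) < p.1.2
            · exact Or.inl ⟨hp, hd⟩
            · obtain ⟨q, hq⟩ := exists_mem_quadrant_rat p
              exact Or.inr ⟨q, EReal.coe_le_coe_iff.1 (hq.2.le.trans (not_lt.1 hd)), hq⟩
          · rintro (hp | ⟨q, hq, hp⟩)
            · exact hp.1
            · exact hp.1.trans (EReal.coe_le_coe_iff.2 hq)
        rw [this]
        exact (hQ le_rfl).union (.iUnion fun q => .iUnion fun _ => hQ le_rfl)
    have h2 : Measurable[m] fun p : BirthDeath => p.1.2 := by
      refine measurable_of_Ioi (mδ := m) fun t => ?_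
      induction t with
      | bot =>
        convert @MeasurableSet.univ _ m
        ext p
        simpa using (p.2.1.trans p.2.2)
      | top =>
        convert @MeasurableSet.empty _ m
        ext p
        simp
      | coe t =>
        have : (fun p : BirthDeath => p.1.2) ⁻¹' Set.Ioi (t : EReal) = quadrant t t ∪
            ⋃ q : ℚ, ⋃ _ : t ≤ (q : ℝ), quadrant ((q : ℝ) : EReal) ((q : ℝ) : EReal) := by
          ext p
          simp only [Set.mem_preimage, Set.mem_Ioi, Set.mem_union, Set.mem_iUnion]
          constructor
          · intro hp
            by_cases hd : p.1.1 ≤ (t : EReal)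
            · exact Or.inl ⟨hd, hp⟩
            · obtain ⟨q, hq⟩ := exists_mem_quadrant_rat p
              exact Or.inr ⟨q, EReal.coe_le_coe_iff.1 ((not_le.1 hd).le.trans hq.1), hq⟩
          · rintro (hp | ⟨q, hq, hp⟩)
            · exact hp.2
            · exact (EReal.coe_le_coe_iff.2 hq).trans_lt hp.2
        rw [this]
        exact (hQ le_rfl).union (.iUnion fun q => .iUnion fun _ => hQ le_rfl)
    exact (@Measurable.prodMk _ m _ _ _ _ _ _ h1 h2).comap_le
  · refine MeasurableSpace.generateFrom_le ?_
    rintro _ ⟨s, t, -, rfl⟩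
    exact measurableSet_quadrant s t

/-- Measures on `Δ` that are finite on quadrants are determined by their values there. -/
lemma measure_ext_quadrant {μ ν : Measure BirthDeath}
    (hfin : ∀ s t : ℝ, s ≤ t → μ (quadrant s t) ≠ ⊤)
    (h : ∀ s t : ℝ, s ≤ t → μ (quadrant s t) = ν (quadrant s t)) : μ = ν := by
  obtain ⟨f, hf⟩ := exists_surjective_nat ℚ
  refine Measure.ext_of_generateFrom_of_iUnion _
    (fun k => quadrant ((f k : ℝ) : EReal) ((f k : ℝ) : EReal)) birthDeath_generateFrom_quadrant ?_
    ?_ (fun k => ⟨f k, f k, le_rfl, rfl⟩) (fun k => hfin _ _ le_rfl) ?_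
  · rintro _ ⟨s, t, hst, rfl⟩ _ ⟨s', t', hst', rfl⟩ -
    refine ⟨min s s', max t t', (min_le_left _ _).trans (hst.trans (le_max_left _ _)), ?_⟩
    rw [quadrant_inter, EReal.coe_strictMono.monotone.map_min, EReal.coe_strictMono.monotone.map_max]
  · refine Set.eq_univ_of_forall fun p => Set.mem_iUnion.2 ?_
    obtain ⟨q, hq⟩ := exists_mem_quadrant_rat p
    obtain ⟨k, rfl⟩ := hf q
    exact ⟨k, hq⟩
  · rintro _ ⟨s, t, hst, rfl⟩
    exact h s t hst

/-- Cardinality replaces rank: for a sum of interval modules the image has `2 ^ r` elements, where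
`r` is the number of points in the quadrant. -/
lemma PersistenceModule.Isomorphic.card_range {M N : PersistenceModule} (h : M.Isomorphic N)
    {s t : ℝ} (hst : s ≤ t) :
    Nat.card (Set.range (M.map hst)) = Nat.card (Set.range (N.map hst)) := by
  obtain ⟨e, he⟩ := h
  have : Set.range (N.map hst) = e t '' Set.range (M.map hst) := by
    ext y
    constructor
    · rintro ⟨z, rfl⟩
      refine ⟨M.map hst ((e s).symm z), ⟨_, rfl⟩, ?_⟩
      rw [he, LinearEquiv.apply_symm_apply]
    · rintro ⟨_, ⟨z, rfl⟩, rfl⟩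
      exact ⟨e s z, (he hst z).symm⟩
  rw [this, Nat.card_image_of_injective (e t).injective]

open Classical in
lemma card_range_intervalMap (p : BirthDeath) {s t : ℝ} (hst : s ≤ t) :
    Nat.card (Set.range (intervalMap p s t)) = if p ∈ quadrant s t then 2 else 1 := by
  split_ifs with h
  · have hs : intervalSpace p s = ⊤ :=
      if_pos ⟨h.1, (EReal.coe_le_coe_iff.2 hst).trans_lt h.2⟩
    have hinj : Function.Injective (intervalMap p s t) := by
      rw [intervalMap, dif_pos ⟨h.1, hst, h.2⟩]
      exact Submodule.inclusion_injective _
    rw [← Nat.card_congr (Equiv.ofInjective _ hinj), hs,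
      Nat.card_congr (Submodule.topEquiv (R := ZMod 2) (M := ZMod 2)).toEquiv, Nat.card_zmod]
  · have : intervalMap p s t = 0 := dif_neg fun h' => h ⟨h'.1, h'.2.2⟩
    rw [this]
    have : Set.range (0 : intervalSpace p s →ₗ[ZMod 2] intervalSpace p t) = {0} := by
      ext y
      simp [eq_comm]
    rw [this, Nat.card_unique]

open Classical in
lemma card_range_directSum {m : ℕ} (p : Fin m → BirthDeath) {s t : ℝ} (hst : s ≤ t) :
    Nat.card (Set.range
      ((PersistenceModule.directSum fun i => intervalModule (p i)).map hst)) =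
      2 ^ (Finset.univ.filter fun i => p i ∈ quadrant s t).card := by
  have : Set.range ((PersistenceModule.directSum fun i => intervalModule (p i)).map hst) =
      Set.pi Set.univ fun i => Set.range (intervalMap (p i) s t) :=
    Set.range_piMap fun i => intervalMap (p i) s t
  rw [this]
  refine (Nat.card_congr (Equiv.Set.univPi fun i => Set.range (intervalMap (p i) s t))).trans ?_
  rw [Nat.card_pi, Finset.prod_congr rfl fun i _ => card_range_intervalMap (p i) hst, Finset.prod_ite]
  simp

lemma sum_dirac_map_univ {m : ℕ} (p : Fin m → BirthDeath) :
    ((Multiset.map p Finset.univ.val).map Measure.dirac).sum = ∑ i, Measure.dirac (p i) := by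
  rw [Multiset.map_map]
  rfl

open Classical in
lemma sum_dirac_apply {m : ℕ} (p : Fin m → BirthDeath) {A : Set BirthDeath}
    (hA : MeasurableSet A) :
    (∑ i, Measure.dirac (p i)) A = (Finset.univ.filter fun i => p i ∈ A).card := by
  rw [Measure.finsetSum_apply]
  simp [Measure.dirac_apply' _ hA, Set.indicator_apply, Finset.sum_boole]

lemma IsPersistenceDiagram.sum_dirac_eq {M : PersistenceModule} {D D' : Multiset BirthDeath}
    (h : IsPersistenceDiagram M D) (h' : IsPersistenceDiagram M D') :
    (D.map Measure.dirac).sum = (D'.map Measure.dirac).sum := by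
  classical
  obtain ⟨m, p, rfl, hp⟩ := h
  obtain ⟨m', p', rfl, hp'⟩ := h'
  rw [sum_dirac_map_univ, sum_dirac_map_univ]
  refine measure_ext_quadrant (fun s t _ => ?_) fun s t hst => ?_
  · rw [sum_dirac_apply _ (measurableSet_quadrant _ _)]
    exact ENNReal.natCast_ne_top _
  · rw [sum_dirac_apply _ (measurableSet_quadrant _ _),
      sum_dirac_apply _ (measurableSet_quadrant _ _)]
    have := (hp.card_range hst).symm.trans (hp'.card_range hst)
    rw [card_range_directSum, card_range_directSum] at this
    rw [Nat.pow_right_injective le_rfl this]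

lemma IsPersistenceDiagram.sum_dirac_persistenceDiagram {M : PersistenceModule}
    {D : Multiset BirthDeath} (h : IsPersistenceDiagram M D) :
    ((persistenceDiagram M).map Measure.dirac).sum = (D.map Measure.dirac).sum := by
  have hex : ∃ D, IsPersistenceDiagram M D := ⟨D, h⟩
  rw [persistenceDiagram, dif_pos hex]
  exact hex.choose_spec.sum_dirac_eq h

/-! ### The diagram of a finite sequence -/

lemma truncatedHeights_succ {a : ℕ → ℝ} {n k : ℕ} (h : k < n) :
    truncatedHeights a n (k + 1) = a k := if_pos h

lemma truncatedHeights_lt_top {a : ℕ → ℝ} {n v : ℕ} (h : truncatedHeights a n v < ⊤) :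
    ∃ k < n, v = k + 1 := by
  cases v with
  | zero => exact absurd h (lt_irrefl _)
  | succ k =>
    refine ⟨k, ?_, rfl⟩
    by_contra hk
    rw [truncatedHeights, if_neg hk] at h
    exact lt_irrefl _ h

lemma mem_Icc_iff_truncatedHeights_lt_top {a : ℕ → ℝ} {n v : ℕ} :
    v ∈ Finset.Icc 1 n ↔ truncatedHeights a n v < ⊤ := by
  rw [Finset.mem_Icc]
  refine ⟨fun h => ?_, fun h => ?_⟩
  · obtain ⟨k, rfl⟩ := Nat.exists_eq_add_of_le' h.1
    rw [truncatedHeights_succ (by omega)]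
    exact EReal.coe_lt_top _
  · obtain ⟨k, hk, rfl⟩ := truncatedHeights_lt_top h
    omega

/-- Among the first `n` terms of `a`, none that is lower than the `k`-th is connected to it at
level `t`. -/
def Survives (a : ℕ → ℝ) (n : ℕ) (t : ℝ) (k : ℕ) : Prop :=
  ∀ j < n, a j < a k → ∃ i ∈ Finset.uIcc k j, t < a i

/-- Term `k` sits at vertex `k + 1`. A segment between two of the first `n` terms contains no vertex
of height `∞`. -/
lemma lt_deathLevel_truncatedHeights_iff {a : ℕ → ℝ} {n k : ℕ} {t : ℝ} (hk : k < n) :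
    (t : EReal) < deathLevel (truncatedHeights a n) (Finset.Icc 1 n) (k + 1) ↔
      Survives a n t k := by
  have hconn (j : ℕ) (hj : j < n) : PathConnected (truncatedHeights a n) t (k + 1) (j + 1) ↔
      ∀ i ∈ Finset.uIcc k j, a i ≤ t := by
    simp only [PathConnected, Finset.mem_uIcc]
    constructor
    · intro h i hi
      have := h (i + 1) (by omega)
      rwa [truncatedHeights_succ (by omega), EReal.coe_le_coe_iff] at this
    · intro h i hi
      obtain ⟨i, rfl⟩ := Nat.exists_eq_add_of_le' (show 1 ≤ i by omega)
      rw [truncatedHeights_succ (by omega), EReal.coe_le_coe_iff]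
      exact h i (by omega)
  rw [lt_deathLevel_iff (fun v => mem_Icc_iff_truncatedHeights_lt_top) (EReal.coe_lt_top t)]
  constructor
  · intro h j hj hlt
    have := h (j + 1) (by
      rwa [truncatedHeights_succ hj, truncatedHeights_succ hk, EReal.coe_lt_coe_iff])
    rw [hconn j hj] at this
    push Not at this
    exact this
  · intro h w hw
    obtain ⟨j, hj, rfl⟩ := truncatedHeights_lt_top (hw.trans_le le_top)
    rw [truncatedHeights_succ hj, truncatedHeights_succ hk, EReal.coe_lt_coe_iff] at hw
    rw [hconn j hj]
    push Not
    exact h j hj hw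

open Classical in
/-- The number of points of the diagram in a set, counted through the vertices. -/
lemma diagramMeasure_apply {a : ℕ → ℝ} (ha : Function.Injective a) (n : ℕ) {A : Set BirthDeath}
    (hA : MeasurableSet A) :
    diagramMeasure a n A = ((Finset.range n).filter fun k =>
      ∃ p ∈ A, p.1 = ((a k : EReal),
        deathLevel (truncatedHeights a n) (Finset.Icc 1 n) (k + 1))).card := by
  set x := truncatedHeights a n
  set S := Finset.Icc 1 n
  have hS : ∀ v, v ∈ S ↔ x v < ⊤ := fun v => mem_Icc_iff_truncatedHeights_lt_top
  have hx : ∀ k < n, x (k + 1) = a k := fun k hk => truncatedHeights_succ hk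
  have hinj : Set.InjOn x S := by
    intro v hv w hw h
    obtain ⟨k, hk, rfl⟩ := truncatedHeights_lt_top ((hS v).1 hv)
    obtain ⟨j, hj, rfl⟩ := truncatedHeights_lt_top ((hS w).1 hw)
    rw [hx k hk, hx j hj, EReal.coe_eq_coe_iff] at h
    rw [ha h]
  -- A term with a lower neighbour dies at its own height and gives no point of Δ.
  let L := (Finset.range n).filter fun k => (a k : EReal) < deathLevel x S (k + 1)
  let e := L.equivFin.symm
  let p (i : Fin L.card) : BirthDeath :=
    ⟨((a (e i) : EReal), deathLevel x S (e i + 1)), EReal.bot_lt_coe _,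
      (Finset.mem_filter.1 (e i).2).2⟩
  have hiso := isomorphic_directSum (vs := fun i => (e i : ℕ) + 1) (p := p) rfl hS hinj
    (fun i j h => e.injective (Subtype.ext (Nat.succ_injective h))) (by
      intro v hv
      obtain ⟨k, hk, rfl⟩ := truncatedHeights_lt_top (hv.trans_le le_top)
      rw [hx k hk] at hv
      exact ⟨e.symm ⟨k, Finset.mem_filter.2 ⟨Finset.mem_range.2 hk, hv⟩⟩, by simp⟩) (by
      intro i
      have := Finset.mem_range.1 (Finset.mem_filter.1 (e i).2).1
      simp only [p, hx _ this])
  have hdiag : IsPersistenceDiagram (persistentHomology₀ x) (Multiset.map p Finset.univ.val) :=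
    ⟨_, p, rfl, hiso⟩
  rw [diagramMeasure, hdiag.sum_dirac_persistenceDiagram, sum_dirac_map_univ, sum_dirac_apply p hA]
  congr 1
  refine Finset.card_bij (fun i _ => (e i : ℕ)) ?_ ?_ ?_
  · intro i hi
    refine Finset.mem_filter.2 ⟨(Finset.mem_filter.1 (e i).2).1, p i, (Finset.mem_filter.1 hi).2, rfl⟩
  · intro i _ j _ h
    exact e.injective (Subtype.ext h)
  · intro k hk
    obtain ⟨hk, q, hq, hqk⟩ := Finset.mem_filter.1 hk
    have hlt := q.2.2
    rw [hqk] at hlt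
    refine ⟨e.symm ⟨k, Finset.mem_filter.2 ⟨hk, hlt⟩⟩, ?_, by simp⟩
    refine Finset.mem_filter.2 ⟨Finset.mem_univ _, ?_⟩
    convert hq
    apply Subtype.ext
    rw [hqk]
    simp [p]

open Classical in
-- As `s ≤ t`, birth ≤ s and death > t already force birth < death, so lying in Δ is no further
-- condition.
lemma diagramMeasure_quadrant {a : ℕ → ℝ} (ha : Function.Injective a) (n : ℕ) {s t : ℝ}
    (hst : s ≤ t) :
    diagramMeasure a n (quadrant s t) = ((Finset.range n).filter fun k =>
      a k ≤ s ∧ Survives a n t k).card := by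
  rw [diagramMeasure_apply ha n (measurableSet_quadrant _ _)]
  congr 2
  refine Finset.filter_congr fun k hk => ?_
  rw [← lt_deathLevel_truncatedHeights_iff (Finset.mem_range.1 hk)]
  constructor
  · rintro ⟨p, hp, h⟩
    simpa [mem_quadrant, h] using hp
  · rintro ⟨h1, h2⟩
    exact ⟨⟨(_, _), EReal.bot_lt_coe _, (EReal.coe_le_coe_iff.2 (h1.trans hst)).trans_lt h2⟩,
      ⟨EReal.coe_le_coe_iff.2 h1, h2⟩, rfl⟩

open Classical in
lemma diagramMeasure_univ {a : ℕ → ℝ} (ha : Function.Injective a) (n : ℕ) :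
    diagramMeasure a n Set.univ = ((Finset.range n).filter fun k =>
      Survives a n (a k) k).card := by
  rw [diagramMeasure_apply ha n MeasurableSet.univ]
  congr 2
  refine Finset.filter_congr fun k hk => ?_
  rw [← lt_deathLevel_truncatedHeights_iff (Finset.mem_range.1 hk)]
  constructor
  · rintro ⟨p, -, h⟩
    have := p.2.2
    rwa [h] at this
  · intro h
    exact ⟨⟨(_, _), EReal.bot_lt_coe _, h⟩, trivial, rfl⟩

/-! ### Frequencies of local patterns -/

lemma tendsto_natDiv_div {m : ℕ} :
    Tendsto (fun n : ℕ => ((n / m : ℕ) : ℝ) / n) atTop (𝓝 (m : ℝ)⁻¹) := by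
  have h := (tendsto_nat_floor_mul_div_atTop (R := ℝ) (a := (m : ℝ)⁻¹) (by positivity)).comp
    tendsto_natCast_atTop_atTop
  refine h.congr fun n => ?_
  simp only [Function.comp_apply]
  rw [inv_mul_eq_div, Nat.floor_div_natCast, Nat.floor_natCast]

/-- Cesàro convergence along all residue classes implies Cesàro convergence. -/
lemma tendsto_average_of_residues {u : ℕ → ℝ} (hu : ∀ v, |u v| ≤ 1) {m : ℕ} (hm : 0 < m) {L : ℝ}
    (h : ∀ r < m, Tendsto (fun q : ℕ => (∑ j ∈ Finset.range q, u (j * m + r)) / q) atTop (𝓝 L)) :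
    Tendsto (fun n : ℕ => (∑ v ∈ Finset.range n, u v) / n) atTop (𝓝 L) := by
  have hm' : (m : ℝ) ≠ 0 := by positivity
  have hblock (q : ℕ) : ∑ v ∈ Finset.range (q * m), u v =
      ∑ r ∈ Finset.range m, ∑ j ∈ Finset.range q, u (j * m + r) := by
    induction q with
    | zero => simp
    | succ q ih =>
      rw [Nat.succ_mul, Finset.sum_range_add, ih, ← Finset.sum_add_distrib]
      simp [Finset.sum_range_succ]
  have hdiv : Tendsto (fun n : ℕ => n / m) atTop atTop := Nat.tendsto_div_const_atTop hm.ne'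
  have h1 : Tendsto (fun n : ℕ => (((n / m : ℕ) : ℝ) / n) *
      ∑ r ∈ Finset.range m, (∑ j ∈ Finset.range (n / m), u (j * m + r)) / (n / m : ℕ))
      atTop (𝓝 L) := by
    have := (tendsto_natDiv_div (m := m)).mul (tendsto_finsetSum (Finset.range m) fun r hr =>
      (h r (Finset.mem_range.1 hr)).comp hdiv)
    simpa [hm'] using this
  -- The incomplete last block has fewer than `m` terms, each bounded by 1.
  have h2 : Tendsto (fun n : ℕ => (∑ i ∈ Finset.range (n % m), u (n / m * m + i)) / n)
      atTop (𝓝 0) := by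
    refine squeeze_zero_norm (fun n => ?_) (tendsto_const_div_atTop_nhds_zero_nat (m : ℝ))
    rw [norm_div, Real.norm_eq_abs, RCLike.norm_natCast]
    gcongr
    refine (Finset.abs_sum_le_sum_abs _ _).trans ((Finset.sum_le_card_nsmul _ _ 1
      fun i _ => hu _).trans ?_)
    simpa using (Nat.mod_lt n hm).le
  refine (add_zero L ▸ h1.add h2).congr fun n => ?_
  have hsplit : ∑ v ∈ Finset.range n, u v = ∑ v ∈ Finset.range (n / m * m), u v +
      ∑ i ∈ Finset.range (n % m), u (n / m * m + i) := by
    rw [← Finset.sum_range_add, Nat.div_add_mod']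
  rw [hsplit, hblock, add_div, ← Finset.sum_div]
  congr 1
  rcases Nat.eq_zero_or_pos (n / m) with h0 | h0
  · simp [h0]
  · field_simp

section Windows

variable {Ω : Type*} [MeasurableSpace Ω] {P : Measure Ω} {X : ℕ → Ω → ℝ}

lemma map_window (hmeas : ∀ i, Measurable (X i)) (hindep : iIndepFun X P)
    (hident : ∀ i, IdentDistrib (X i) (X 0) P P) (m v : ℕ) :
    P.map (fun ω (i : Fin m) => X (v + i) ω) = Measure.pi fun _ => P.map (X 0) := by
  have h : iIndepFun (fun i : Fin m => X (v + i)) P :=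
    hindep.precomp (g := fun i : Fin m => v + (i : ℕ)) fun i j hij =>
      Fin.ext (Nat.add_left_cancel hij)
  rw [h.map_fun_eq_pi_map fun i => (hmeas _).aemeasurable]
  congr 1
  funext i
  exact (hident _).map_eq

variable [IsProbabilityMeasure P]

/-- The strong law of large numbers for functions of `m` consecutive terms. -/
lemma ae_tendsto_average_window (hmeas : ∀ i, Measurable (X i)) (hindep : iIndepFun X P)
    (hident : ∀ i, IdentDistrib (X i) (X 0) P P) {m : ℕ} (hm : 0 < m) {f : (Fin m → ℝ) → ℝ}
    (hf : Measurable f) (hf1 : ∀ y, |f y| ≤ 1) :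
    ∀ᵐ ω ∂P, Tendsto
      (fun n : ℕ => (∑ v ∈ Finset.range n, f fun i : Fin m => X (v + i) ω) / n) atTop
      (𝓝 (∫ ω, f (fun i : Fin m => X i ω) ∂P)) := by
  have hY (v : ℕ) : Measurable fun ω => f fun i : Fin m => X (v + i) ω :=
    hf.comp (measurable_pi_lambda _ fun i => hmeas _)
  have hid (v w : ℕ) : IdentDistrib (fun ω => f fun i : Fin m => X (v + i) ω)
      (fun ω => f fun i : Fin m => X (w + i) ω) P P := by
    refine IdentDistrib.comp (u := f) ⟨?_, ?_, ?_⟩ hf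
    · exact (measurable_pi_lambda _ fun i => hmeas _).aemeasurable
    · exact (measurable_pi_lambda _ fun i => hmeas _).aemeasurable
    · rw [map_window hmeas hindep hident, map_window hmeas hindep hident]
  -- Windows of length `m` that start in one residue class mod `m` are disjoint, hence pairwise
  -- independent, which is all that the strong law requires.
  have hres : ∀ r : ℕ, ∀ᵐ ω ∂P, Tendsto (fun q : ℕ =>
      (∑ j ∈ Finset.range q, f fun i : Fin m => X (j * m + r + i) ω) / q) atTop
      (𝓝 (∫ ω, f (fun i : Fin m => X i ω) ∂P)) := by
    intro r
    have := strong_law_ae_real (μ := P) (fun j ω => f fun i : Fin m => X (j * m + r + i) ω)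
      (Integrable.of_bound (hY _).aestronglyMeasurable 1 (ae_of_all _ fun ω => hf1 _))
      (fun j k hjk => ?_) (fun j => hid _ _)
    · have he : (∫ ω, f (fun i : Fin m => X (0 * m + r + i) ω) ∂P) =
          ∫ ω, f (fun i : Fin m => X i ω) ∂P := by
        simpa using (hid (0 * m + r) 0).integral_eq
      simpa only [he] using this
    · have hdisj : Disjoint (Finset.Ico (j * m + r) (j * m + r + m))
          (Finset.Ico (k * m + r) (k * m + r + m)) := by
        rw [Finset.disjoint_left]
        intro i hi hi'
        rw [Finset.mem_Ico] at hi hi'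
        rcases lt_or_gt_of_ne hjk with h | h
        · have := Nat.mul_le_mul_right m (Nat.succ_le_of_lt h)
          rw [Nat.succ_mul] at this
          omega
        · have := Nat.mul_le_mul_right m (Nat.succ_le_of_lt h)
          rw [Nat.succ_mul] at this
          omega
      have hwin (v : ℕ) : Measurable fun (y : Finset.Ico v (v + m) → ℝ) =>
          f fun i : Fin m => y ⟨v + i, Finset.mem_Ico.2 ⟨by omega, by omega⟩⟩ :=
        hf.comp (measurable_pi_lambda _ fun i => measurable_pi_apply _)
      exact (hindep.indepFun_finset _ _ hdisj hmeas).comp (hwin (j * m + r)) (hwin (k * m + r))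
  filter_upwards [ae_all_iff.2 hres] with ω hω
  exact tendsto_average_of_residues (fun v => hf1 _) hm fun r _ => hω r

/-- The probability of a pattern, computed by conditioning on the term at its centre `c`. -/
lemma measure_pattern (hmeas : ∀ i, Measurable (X i)) (hindep : iIndepFun X P)
    (hident : ∀ i, IdentDistrib (X i) (X 0) P P) {c : ℕ} {J : Finset ℕ} (hc : c ∉ J)
    {T : Set ℝ} (hT : MeasurableSet T) {S : ℕ → Set (ℝ × ℝ)} (hS : ∀ i, MeasurableSet (S i)) :
    P {ω | X c ω ∈ T ∧ ∀ i ∈ J, (X c ω, X i ω) ∈ S i} =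
      ∫⁻ x in T, ∏ i ∈ J, P.map (X 0) (Prod.mk x ⁻¹' S i) ∂(P.map (X 0)) := by
  have hi : IndepFun (X c) (fun ω (i : J) => X i ω) P := by
    have := hindep.indepFun_finset {c} J (by simpa using hc) hmeas
    exact this.comp (φ := fun y : ({c} : Finset ℕ) → ℝ => y ⟨c, Finset.mem_singleton_self c⟩)
      (ψ := id) (measurable_pi_apply _) measurable_id
  have hmJ : Measurable fun ω (i : J) => X i ω := measurable_pi_lambda _ fun i => hmeas _
  have hprob (i : ℕ) : IsProbabilityMeasure (P.map (X i)) :=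
    Measure.isProbabilityMeasure_map (hmeas i).aemeasurable
  have hpi : P.map (fun ω (i : J) => X i ω) = Measure.pi fun _ => P.map (X 0) := by
    have h : iIndepFun (fun i : J => X i) P :=
      hindep.precomp (g := fun i : J => (i : ℕ)) Subtype.val_injective
    rw [h.map_fun_eq_pi_map fun i => (hmeas _).aemeasurable]
    congr 1
    funext i
    exact (hident _).map_eq
  have hA : MeasurableSet {z : ℝ × (J → ℝ) | z.1 ∈ T ∧ ∀ i : J, (z.1, z.2 i) ∈ S i} := by
    have : {z : ℝ × (J → ℝ) | z.1 ∈ T ∧ ∀ i : J, (z.1, z.2 i) ∈ S i} =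
        Prod.fst ⁻¹' T ∩ ⋂ i : J, (fun z : ℝ × (J → ℝ) => (z.1, z.2 i)) ⁻¹' S i := by
      ext z
      simp
    rw [this]
    exact (measurable_fst hT).inter (.iInter fun i =>
      (measurable_fst.prodMk ((measurable_pi_apply i).comp measurable_snd)) (hS i))
  have hmap := hi.map_prod_eq_prod_map_map (hmeas c).aemeasurable hmJ.aemeasurable
  rw [hpi, (hident c).map_eq] at hmap
  have hset : {ω | X c ω ∈ T ∧ ∀ i ∈ J, (X c ω, X i ω) ∈ S i} =
      (fun ω => (X c ω, fun i : J => X i ω)) ⁻¹'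
        {z : ℝ × (J → ℝ) | z.1 ∈ T ∧ ∀ i : J, (z.1, z.2 i) ∈ S i} := by
    ext ω
    simp
  rw [hset, ← Measure.map_apply ((hmeas c).prodMk hmJ) hA, hmap, Measure.prod_apply hA,
    ← lintegral_indicator hT]
  refine lintegral_congr fun x => ?_
  by_cases hx : x ∈ T
  · rw [Set.indicator_of_mem hx, ← Finset.prod_coe_sort, ← Measure.pi_pi]
    congr 1
    ext y
    simp [hx]
  · rw [Set.indicator_of_notMem hx]
    simp [hx]

/-- Almost surely, the asymptotic frequency of a pattern is its probability. -/
lemma ae_tendsto_pattern_frequency (hmeas : ∀ i, Measurable (X i)) (hindep : iIndepFun X P)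
    (hident : ∀ i, IdentDistrib (X i) (X 0) P P) {c : ℕ} {J : Finset ℕ} (hc : c ∉ J)
    {T : Set ℝ} (hT : MeasurableSet T) {S : ℕ → Set (ℝ × ℝ)} (hS : ∀ i, MeasurableSet (S i))
    {p : Ω → ℕ → Prop} [∀ ω, DecidablePred (p ω)] (hp : ∀ ω v, p ω v ↔
      X (v + c) ω ∈ T ∧ ∀ i ∈ J, (X (v + c) ω, X (v + i) ω) ∈ S i) :
    ∀ᵐ ω ∂P, Tendsto (fun n : ℕ => (((Finset.range n).filter (p ω)).card : ℝ) / n) atTop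
      (𝓝 (∫⁻ x in T, ∏ i ∈ J, P.map (X 0) (Prod.mk x ⁻¹' S i) ∂(P.map (X 0))).toReal) := by
  classical
  obtain ⟨m, hcm, hJm⟩ : ∃ m, c < m ∧ ∀ i ∈ J, i < m :=
    ⟨c + J.sup id + 1, by omega, fun i hi => by
      have : i ≤ J.sup id := Finset.le_sup (f := id) hi
      omega⟩
  let B : Set (Fin m → ℝ) := {y | y ⟨c, hcm⟩ ∈ T ∧ ∀ i (hi : i ∈ J), (y ⟨c, hcm⟩, y ⟨i, hJm i hi⟩) ∈ S i}
  have hB : MeasurableSet B := by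
    have : B = (fun y => y ⟨c, hcm⟩) ⁻¹' T ∩
        ⋂ i, ⋂ hi : i ∈ J, (fun y => (y ⟨c, hcm⟩, y ⟨i, hJm i hi⟩)) ⁻¹' S i := by
      ext y
      simp [B]
    rw [this]
    exact (measurable_pi_apply (⟨c, hcm⟩ : Fin m) hT).inter (.iInter fun i => .iInter fun hi =>
      ((measurable_pi_apply (⟨c, hcm⟩ : Fin m)).prodMk
        (measurable_pi_apply (⟨i, hJm i hi⟩ : Fin m))) (hS i))
  have h := ae_tendsto_average_window hmeas hindep hident (by omega) (f := B.indicator 1)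
    (measurable_one.indicator hB) (fun y => by
      by_cases hy : y ∈ B <;> simp [hy])
  have hlim : ∫ ω, B.indicator 1 (fun i : Fin m => X i ω) ∂P =
      (∫⁻ x in T, ∏ i ∈ J, P.map (X 0) (Prod.mk x ⁻¹' S i) ∂(P.map (X 0))).toReal := by
    have hX : Measurable fun ω (i : Fin m) => X i ω := measurable_pi_lambda _ fun i => hmeas _
    have : (fun ω => B.indicator (1 : (Fin m → ℝ) → ℝ) (fun i : Fin m => X i ω)) =
        ((fun ω (i : Fin m) => X i ω) ⁻¹' B).indicator 1 := rfl
    rw [this, integral_indicator_one (hX hB), Measure.real,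
      ← measure_pattern hmeas hindep hident hc hT hS]
    rfl
  filter_upwards [h] with ω hω
  rw [← hlim]
  refine hω.congr fun n => ?_
  rw [Finset.card_filter, Nat.cast_sum]
  congr 1
  refine Finset.sum_congr rfl fun v _ => ?_
  rw [Set.indicator_apply, Nat.cast_ite, Nat.cast_one, Nat.cast_zero]
  exact if_congr (hp ω v).symm rfl rfl

end Windows

/-! ### The distribution function of an atomless law -/

section Law

variable {μ : Measure ℝ}

lemma measurable_cdf : Measurable (cdf μ) := (monotone_cdf μ).measurable

variable [IsProbabilityMeasure μ] [NullSingletonClass μ]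

/-- The jump at `x` is the mass of `{x}`. -/
lemma continuous_cdf : Continuous (cdf μ) := by
  rw [continuous_iff_continuousAt]
  intro x
  rw [(monotone_cdf μ).continuousAt_iff_leftLim_eq_rightLim, (cdf μ).rightLim_eq]
  refine le_antisymm ((monotone_cdf μ).leftLim_le le_rfl) ?_
  have h : μ {x} = 0 := measure_singleton x
  rw [← measure_cdf μ, StieltjesFunction.measure_singleton, ENNReal.ofReal_eq_zero] at h
  linarith

/-- The probability integral transform. -/
lemma map_cdf : μ.map (cdf μ) = volume.restrict (Set.Icc 0 1) := by
  have : IsProbabilityMeasure (μ.map (cdf μ)) :=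
    Measure.isProbabilityMeasure_map measurable_cdf.aemeasurable
  refine Measure.ext_of_Iic _ _ fun u => ?_
  rw [Measure.map_apply measurable_cdf measurableSet_Iic, Measure.restrict_apply measurableSet_Iic]
  rcases lt_or_ge u 0 with hu | hu
  · have h1 : cdf μ ⁻¹' Set.Iic u = ∅ := by
      ext x
      simpa using hu.trans_le (cdf_nonneg μ x)
    have h2 : Set.Iic u ∩ Set.Icc 0 1 = ∅ := by
      ext x
      simp only [Set.mem_inter_iff, Set.mem_Iic, Set.mem_Icc, Set.mem_empty_iff_false, iff_false]
      intro h
      linarith [h.1, h.2.1]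
    rw [h1, h2, measure_empty, measure_empty]
  rcases le_or_gt 1 u with hu1 | hu1
  · have h1 : cdf μ ⁻¹' Set.Iic u = Set.univ := by
      ext x
      simpa using (cdf_le_one μ x).trans hu1
    have h2 : Set.Iic u ∩ Set.Icc 0 1 = Set.Icc 0 1 :=
      Set.inter_eq_right.2 fun x hx => hx.2.trans hu1
    rw [h1, h2, measure_univ, Real.volume_Icc]
    simp
  have h2 : Set.Iic u ∩ Set.Icc 0 1 = Set.Icc 0 u := by
    ext x
    simp only [Set.mem_inter_iff, Set.mem_Iic, Set.mem_Icc]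
    constructor
    · exact fun h => ⟨h.2.1, h.1⟩
    · exact fun h => ⟨h.2, h.1, h.2.trans hu1.le⟩
  rw [h2, Real.volume_Icc, sub_zero]
  have hsurj : ∀ v, 0 < v → v < 1 → ∃ x, cdf μ x = v := by
    intro v hv hv1
    refine mem_range_of_exists_le_of_exists_ge continuous_cdf ?_ ?_
    · exact ((tendsto_cdf_atBot μ).eventually_le_const hv).exists
    · exact ((tendsto_cdf_atTop μ).eventually_const_le hv1).exists
  apply le_antisymm
  -- The distribution function may be constant on intervals, so a preimage of `u` itself need not
  -- bound `{F ≤ u}`; a preimage of any `c > u` does.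
  · refine le_of_forall_gt_imp_ge_of_dense fun c hc => ?_
    rcases le_or_gt 1 c with hc1 | hc1
    · exact prob_le_one.trans hc1
    · lift c to NNReal using hc1.ne_top
      have huc : u < c := by
        rw [← ENNReal.ofReal_coe_nnreal] at hc
        exact (ENNReal.ofReal_lt_ofReal_iff_of_nonneg hu).1 hc
      obtain ⟨x, hx⟩ := hsurj c (hu.trans_lt huc) (by exact_mod_cast hc1)
      have hle : cdf μ ⁻¹' Set.Iic u ⊆ Set.Iic x := by
        intro y hy
        by_contra hxy
        have := monotone_cdf μ (not_le.1 hxy).le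
        rw [Set.mem_preimage, Set.mem_Iic] at hy
        linarith
      refine (measure_mono hle).trans ?_
      rw [← ofReal_cdf, hx, ENNReal.ofReal_coe_nnreal]
  · rcases hu.eq_or_lt with rfl | hu0
    · simp
    · obtain ⟨x, hx⟩ := hsurj u hu0 hu1
      rw [← hx, ofReal_cdf]
      exact measure_mono fun y hy => monotone_cdf μ hy

lemma lintegral_comp_cdf {h : ℝ → ENNReal} (hh : Measurable h) :
    ∫⁻ x, h (cdf μ x) ∂μ = ∫⁻ v in Set.Icc 0 1, h v := by
  rw [← map_cdf (μ := μ), lintegral_map hh measurable_cdf]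

lemma ae_cdf_ne (c : ℝ) : ∀ᵐ x ∂μ, cdf μ x ≠ c := by
  have : ∀ᵐ v ∂(μ.map (cdf μ)), v ≠ c := by
    rw [map_cdf]
    exact Measure.ae_ne _ c
  exact ae_of_ae_map measurable_cdf.aemeasurable this

lemma ae_cdf_pos : ∀ᵐ x ∂μ, 0 < cdf μ x := by
  filter_upwards [ae_cdf_ne (μ := μ) 0] with x hx
  exact lt_of_le_of_ne (cdf_nonneg μ x) hx.symm

/-- The events `y > t` and `F(y) > F(t)` differ only where `F(y) = F(t)`, a null set. -/
lemma lintegral_Ioi_comp_cdf {h : ℝ → ENNReal} (hh : Measurable h) (t : ℝ) :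
    ∫⁻ y in Set.Ioi t, h (cdf μ y) ∂μ = ∫⁻ v in Set.Ioc (cdf μ t) 1, h v := by
  have h1 : ∫⁻ y in Set.Ioi t, h (cdf μ y) ∂μ =
      ∫⁻ y, (Set.Ioi (cdf μ t)).indicator h (cdf μ y) ∂μ := by
    rw [← lintegral_indicator measurableSet_Ioi]
    refine lintegral_congr_ae ?_
    filter_upwards [ae_cdf_ne (cdf μ t)] with y hy
    by_cases hty : t < y
    · have : cdf μ t < cdf μ y := lt_of_le_of_ne (monotone_cdf μ hty.le) hy.symm
      rw [Set.indicator_of_mem (Set.mem_Ioi.2 hty), Set.indicator_of_mem (Set.mem_Ioi.2 this)]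
    · have : ¬ cdf μ t < cdf μ y := not_lt.2 (monotone_cdf μ (not_lt.1 hty))
      rw [Set.indicator_of_notMem (by simpa using hty), Set.indicator_of_notMem (by simpa using this)]
  rw [h1, lintegral_comp_cdf (hh.indicator measurableSet_Ioi), lintegral_indicator measurableSet_Ioi,
    Measure.restrict_restrict measurableSet_Ioi]
  congr 2
  ext v
  simp only [Set.mem_inter_iff, Set.mem_Ioi, Set.mem_Icc, Set.mem_Ioc]
  exact ⟨fun h => ⟨h.1, h.2.2⟩, fun h => ⟨h.1, (cdf_nonneg μ t).trans h.1.le, h.2⟩⟩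

end Law

lemma lintegral_Ioc_ofReal_eq_sub {f f' : ℝ → ℝ} {a b : ℝ} (hab : a ≤ b)
    (hderiv : ∀ v ∈ Set.Icc a b, HasDerivAt f (f' v) v) (hcont : ContinuousOn f' (Set.Icc a b))
    (hpos : ∀ v ∈ Set.Icc a b, 0 ≤ f' v) :
    ∫⁻ v in Set.Ioc a b, ENNReal.ofReal (f' v) = ENNReal.ofReal (f b - f a) := by
  have hint : IntervalIntegrable f' volume a b :=
    ContinuousOn.intervalIntegrable (by rwa [Set.uIcc_of_le hab])
  rw [← intervalIntegral.integral_eq_sub_of_hasDerivAt (by rwa [Set.uIcc_of_le hab]) hint,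
    intervalIntegral.integral_of_le hab, ofReal_integral_eq_lintegral_ofReal]
  · exact (intervalIntegrable_iff_integrableOn_Ioc_of_le hab).1 hint
  · exact (ae_restrict_iff' measurableSet_Ioc).2
      (ae_of_all _ fun v hv => hpos v (Set.Ioc_subset_Icc_self hv))

lemma lintegral_three_mul_sq :
    ∫⁻ v in Set.Icc (0 : ℝ) 1, ENNReal.ofReal (3 * (1 - v) ^ 2) = 1 := by
  rw [← restrict_Ioc_eq_restrict_Icc, lintegral_Ioc_ofReal_eq_sub (f := fun v => -(1 - v) ^ 3)
    zero_le_one]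
  · simp
  · intro v _
    have := (((hasDerivAt_id v).const_sub 1).pow 3).neg
    refine this.congr_deriv ?_
    simp
  · fun_prop
  · intro v _
    positivity

/-- The integrand is the derivative of `-3 ((1 - v) / (1 - v + u))²`, which vanishes at `v = 1`.
Here `u` and `v` stand for the values of the distribution function at birth and death. -/
lemma lintegral_death_density {u a : ℝ} (hu : 0 < u) (ha : a ≤ 1) :
    ∫⁻ v in Set.Ioc a 1, ENNReal.ofReal (6 * u * (1 - v) / (u + (1 - v)) ^ 3) =
      ENNReal.ofReal (3 * ((1 - a) / (1 - a + u)) ^ 2) := by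
  have hne : ∀ v ∈ Set.Icc a 1, 1 - v + u ≠ 0 := by
    intro v hv
    have := hv.2
    exact (by linarith : (0:ℝ) < 1 - v + u).ne'
  rw [lintegral_Ioc_ofReal_eq_sub (f := fun v => -(3 * ((1 - v) / (1 - v + u)) ^ 2)) ha]
  · simp
  · intro v hv
    have h1 := (hasDerivAt_id v).const_sub 1
    have := (((h1.div (h1.add_const u) (hne v hv)).pow 2).const_mul 3).neg
    refine this.congr_deriv ?_
    have h2 := hne v hv
    rw [add_comm u, show (2 - 1 : ℕ) = 1 from rfl, pow_one]
    simp only [id, Pi.div_apply]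
    field_simp
    ring
  · refine ContinuousOn.div (by fun_prop) (by fun_prop) fun v hv => pow_ne_zero _ ?_
    rw [add_comm]
    exact hne v hv
  · intro v hv
    have : 0 ≤ 1 - v := by linarith [hv.2]
    positivity

/-! ### The limiting measure -/

/-- The density of the limiting measure with respect to `μ ⊗ μ`. -/
def deathDensity (μ : Measure ℝ) (z : ℝ × ℝ) : ENNReal :=
  {z : ℝ × ℝ | z.1 < z.2}.indicator (fun z =>
    ENNReal.ofReal (6 * cdf μ z.1 * (1 - cdf μ z.2) / (cdf μ z.1 + (1 - cdf μ z.2)) ^ 3)) z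

lemma measurable_deathDensity (μ : Measure ℝ) : Measurable (deathDensity μ) := by
  have h1 : Measurable fun z : ℝ × ℝ => cdf μ z.1 := measurable_cdf.comp measurable_fst
  have h2 : Measurable fun z : ℝ × ℝ => cdf μ z.2 := measurable_cdf.comp measurable_snd
  refine Measurable.indicator ?_ (measurableSet_lt measurable_fst measurable_snd)
  fun_prop

open Classical in
/-- A pair of reals as a birth-death pair; the death is `∞` unless it is larger than the birth. -/
def toBirthDeath (z : ℝ × ℝ) : BirthDeath :=
  ⟨((z.1 : EReal), if z.1 < z.2 then (z.2 : EReal) else ⊤), EReal.bot_lt_coe _, by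
    split_ifs with h
    · exact EReal.coe_lt_coe_iff.2 h
    · exact EReal.coe_lt_top _⟩

lemma toBirthDeath_of_lt {x y : ℝ} (h : x < y) :
    (toBirthDeath (x, y)).1 = ((x : EReal), (y : EReal)) :=
  Prod.ext rfl (if_pos h)

lemma measurable_toBirthDeath : Measurable toBirthDeath := by
  refine Measurable.subtype_mk (Measurable.prodMk (by fun_prop) ?_)
  exact Measurable.ite (measurableSet_lt measurable_fst measurable_snd) (by fun_prop)
    measurable_const

/-- The limit of the normalized persistence diagrams. -/
def limitMeasure (μ : Measure ℝ) : Measure BirthDeath :=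
  ((μ.prod μ).withDensity (deathDensity μ)).map toBirthDeath

section LimitMeasure

variable {μ : Measure ℝ} [IsProbabilityMeasure μ] [NullSingletonClass μ]

/-- For sets in which a birth `x ∈ T` admits exactly the deaths beyond `θ x`, the integral over the
deaths is explicit. Quadrants have constant `θ`, the sets Δ_ℓ have `θ x = x + ℓ`, and the whole
space has `θ = id`. -/
lemma limitMeasure_apply {A : Set BirthDeath} (hA : MeasurableSet A) {T : Set ℝ}
    (hT : MeasurableSet T) {θ : ℝ → ℝ} (hθ : ∀ x ∈ T, x ≤ θ x)
    (h : ∀ x y, x < y → (toBirthDeath (x, y) ∈ A ↔ x ∈ T ∧ θ x < y)) :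
    limitMeasure μ A = ∫⁻ x in T,
      ENNReal.ofReal (3 * ((1 - cdf μ (θ x)) / (1 - cdf μ (θ x) + cdf μ x)) ^ 2) ∂μ := by
  classical
  have hpre := measurable_toBirthDeath hA
  -- The density vanishes off `x < y`, so the default death `∞` of `toBirthDeath` carries no mass.
  have hzero (x y : ℝ) (hxy : ¬ x < y) :
      (toBirthDeath ⁻¹' A).indicator (deathDensity μ) (x, y) = 0 := by
    rw [Set.indicator_apply, deathDensity,
      Set.indicator_of_notMem (s := {z : ℝ × ℝ | z.1 < z.2}) hxy, ite_self]
  rw [limitMeasure, Measure.map_apply measurable_toBirthDeath hA, withDensity_apply _ hpre,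
    ← lintegral_indicator hpre,
    lintegral_prod _ ((measurable_deathDensity μ).indicator hpre).aemeasurable,
    ← lintegral_indicator hT]
  refine lintegral_congr_ae ?_
  filter_upwards [ae_cdf_pos (μ := μ)] with x hx
  by_cases hxT : x ∈ T
  · rw [Set.indicator_of_mem hxT, ← lintegral_death_density hx (cdf_le_one μ _),
      ← lintegral_Ioi_comp_cdf (by fun_prop), ← lintegral_indicator measurableSet_Ioi]
    refine lintegral_congr fun y => ?_
    by_cases hy : θ x < y
    · have hxy := (hθ x hxT).trans_lt hy
      rw [Set.indicator_of_mem (Set.mem_Ioi.2 hy),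
        Set.indicator_of_mem (Set.mem_preimage.2 ((h x y hxy).2 ⟨hxT, hy⟩)), deathDensity,
        Set.indicator_of_mem (by exact hxy)]
    · rw [Set.indicator_of_notMem (s := Set.Ioi (θ x)) hy]
      by_cases hxy : x < y
      · exact Set.indicator_of_notMem (s := toBirthDeath ⁻¹' A)
          (fun h' => hy ((h x y hxy).1 h').2) _
      · exact hzero x y hxy
  · rw [Set.indicator_of_notMem hxT]
    refine (lintegral_congr fun y => ?_).trans lintegral_zero
    by_cases hxy : x < y
    · exact Set.indicator_of_notMem (s := toBirthDeath ⁻¹' A)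
        (fun h' => hxT ((h x y hxy).1 h').1) _
    · exact hzero x y hxy

lemma limitMeasure_quadrant {s t : ℝ} (hst : s ≤ t) :
    limitMeasure μ (quadrant s t) = ∫⁻ x in Set.Iic s,
      ENNReal.ofReal (3 * ((1 - cdf μ t) / (1 - cdf μ t + cdf μ x)) ^ 2) ∂μ := by
  refine limitMeasure_apply (θ := fun _ => t) (measurableSet_quadrant _ _) measurableSet_Iic
    (fun x hx => le_trans hx hst) fun x y hxy => ?_
  rw [mem_quadrant, toBirthDeath_of_lt hxy]
  simp

lemma mem_lifetimeGT_toBirthDeath {x y ℓ : ℝ} (hxy : x < y) :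
    toBirthDeath (x, y) ∈ lifetimeGT ℓ ↔ x + ℓ < y := by
  change (ℓ : EReal) < (toBirthDeath (x, y)).1.2 - (toBirthDeath (x, y)).1.1 ↔ _
  rw [toBirthDeath_of_lt hxy, ← EReal.coe_sub, EReal.coe_lt_coe_iff, lt_sub_iff_add_lt']

lemma measurableSet_lifetimeGT (ℓ : ℝ) : MeasurableSet (lifetimeGT ℓ) := by
  have : Measurable fun p : BirthDeath => p.1.2 - p.1.1 := measurable_death.sub measurable_birth
  exact this measurableSet_Ioi

lemma limitMeasure_lifetimeGT {ℓ : ℝ} (hℓ : 0 ≤ ℓ) :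
    limitMeasure μ (lifetimeGT ℓ) = ∫⁻ x,
      ENNReal.ofReal (3 * ((1 - cdf μ (x + ℓ)) / (1 - cdf μ (x + ℓ) + cdf μ x)) ^ 2) ∂μ := by
  rw [← setLIntegral_univ]
  refine limitMeasure_apply (θ := fun x => x + ℓ) (measurableSet_lifetimeGT ℓ) MeasurableSet.univ
    (fun x _ => by linarith) fun x y hxy => ?_
  simp [mem_lifetimeGT_toBirthDeath hxy]

lemma lintegral_three_mul_one_sub_cdf_sq :
    ∫⁻ x, ENNReal.ofReal (3 * (1 - cdf μ x) ^ 2) ∂μ = 1 := by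
  rw [lintegral_comp_cdf (h := fun v => ENNReal.ofReal (3 * (1 - v) ^ 2)) (by fun_prop),
    lintegral_three_mul_sq]

/-- With `θ = id` the denominator is 1, and the total mass is `3 ∫ (1 - F)² dF = 1`. -/
instance isProbabilityMeasure_limitMeasure : IsProbabilityMeasure (limitMeasure μ) := by
  refine ⟨?_⟩
  rw [limitMeasure_apply (T := Set.univ) (θ := id) MeasurableSet.univ MeasurableSet.univ
    (fun x _ => le_rfl) (fun x y hxy => by simpa using hxy), setLIntegral_univ,
    ← lintegral_three_mul_one_sub_cdf_sq (μ := μ)]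
  simp

end LimitMeasure

/-! ### Limits from lower bounds -/

/-- Fatou's lemma for series: a finite partial sum of the limits already exceeds `y`. -/
lemma eventually_lt_of_sum_le {K : Type*} {L : K → ℝ} (hL : Summable L) {p : K → Prop}
    {f : K → ℕ → ℝ} {A : ℕ → ℝ} (hf : ∀ κ, Tendsto (f κ) atTop (𝓝 (L κ)))
    (hA : ∀ F : Finset K, (∀ κ ∈ F, p κ) → ∀ n, ∑ κ ∈ F, f κ n ≤ A n) {y : ℝ}
    (hy : y < ∑' κ : {κ // p κ}, L κ) : ∀ᶠ n in atTop, y < A n := by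
  have hsum : HasSum (fun κ : {κ // p κ} => L κ) (∑' κ : {κ // p κ}, L κ) :=
    (hL.comp_injective Subtype.val_injective).hasSum
  obtain ⟨F, hF⟩ := ((hsum.eventually (lt_mem_nhds hy))).exists
  have hlim : Tendsto (fun n => ∑ κ ∈ F, f κ n) atTop (𝓝 (∑ κ ∈ F, L κ)) :=
    tendsto_finsetSum _ fun κ _ => hf κ
  filter_upwards [hlim.eventually (lt_mem_nhds hF)] with n hn
  refine hn.trans_le (le_trans (le_of_eq ?_)
    (hA (F.map (Function.Embedding.subtype p)) (by simp +contextual) n))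
  rw [Finset.sum_map]
  rfl

/-- If two sequences are bounded below by the partial sums of two complementary families, and their
sum converges to the total sum, then each of them converges. -/
lemma tendsto_of_sum_le {K : Type*} {L : K → ℝ} (hL : Summable L) {p : K → Prop}
    {f : K → ℕ → ℝ} {A B C : ℕ → ℝ} (hf : ∀ κ, Tendsto (f κ) atTop (𝓝 (L κ)))
    (hA : ∀ F : Finset K, (∀ κ ∈ F, p κ) → ∀ n, ∑ κ ∈ F, f κ n ≤ A n)
    (hB : ∀ F : Finset K, (∀ κ ∈ F, ¬ p κ) → ∀ n, ∑ κ ∈ F, f κ n ≤ B n)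
    (hC : ∀ n, A n + B n = C n) (hlim : Tendsto C atTop (𝓝 (∑' κ, L κ))) :
    Tendsto A atTop (𝓝 (∑' κ : {κ // p κ}, L κ)) := by
  have hadd : ∑' κ : {κ // p κ}, L κ + ∑' κ : {κ // ¬ p κ}, L κ = ∑' κ, L κ :=
    Summable.tsum_add_tsum_compl (s := {κ | p κ}) (hL.comp_injective Subtype.val_injective)
      (hL.comp_injective Subtype.val_injective)
  rw [tendsto_order]
  refine ⟨fun y hy => eventually_lt_of_sum_le hL hf hA hy, fun y hy => ?_⟩
  -- The upper bound comes from `A = C - B`: half of `δ` is spent on `C` from above and half on `B`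
  -- from below.
  set δ := y - ∑' κ : {κ // p κ}, L κ with hδ
  have h1 := eventually_lt_of_sum_le hL hf hB
    (show ∑' κ : {κ // ¬ p κ}, L κ - δ / 2 < ∑' κ : {κ // ¬ p κ}, L κ by linarith)
  have h2 := hlim.eventually (gt_mem_nhds (show ∑' κ, L κ < ∑' κ, L κ + δ / 2 by linarith))
  filter_upwards [h1, h2] with n hn1 hn2
  linarith [hC n]

/-- Patterns have to fit into the first `n` terms, which removes the last `c` starting positions; a
bounded loss leaves frequencies unchanged. -/
lemma tendsto_shift_div {N : ℕ → ℕ} {L : ℝ}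
    (h : Tendsto (fun n => (N n : ℝ) / n) atTop (𝓝 L)) (c : ℕ) :
    Tendsto (fun n => (N (n - c) : ℝ) / n) atTop (𝓝 L) := by
  have h1 := h.comp (tendsto_sub_atTop_nat c)
  have h2 : Tendsto (fun n : ℕ => ((n - c : ℕ) : ℝ) / n) atTop (𝓝 1) := by
    have h3 : Tendsto (fun n : ℕ => 1 - (c : ℝ) / n) atTop (𝓝 (1 - 0)) :=
      tendsto_const_nhds.sub (tendsto_const_div_atTop_nhds_zero_nat _)
    rw [sub_zero] at h3
    refine h3.congr' ?_
    filter_upwards [eventually_ge_atTop c, eventually_gt_atTop 0] with n hn hn0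
    rw [Nat.cast_sub hn]
    field_simp
  refine (mul_one L ▸ h1.mul h2).congr' ?_
  filter_upwards [eventually_gt_atTop c] with n hn
  have : ((n - c : ℕ) : ℝ) ≠ 0 := by
    rw [Nat.cast_ne_zero]
    omega
  simp only [Function.comp_apply]
  field_simp

/-! ### Exit patterns -/

/-- How a path that starts at height `z.1` leaves `[z.1, t]`: upwards or downwards. -/
def exitSet (t : ℝ) (b : Bool) : Set (ℝ × ℝ) := if b then {z | t < z.2} else {z | z.2 < z.1}

/-- The steps of an exit pattern `κ = (k, l, α, β)` with centre `k + 1`: on the left, `k` steps in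
`[z.1, t]` and then an exit of type `α`; on the right, `l` such steps and an exit of type `β`. -/
def exitStep (t : ℝ) (κ : ℕ × ℕ × Bool × Bool) (i : ℕ) : Set (ℝ × ℝ) :=
  if i = 0 then exitSet t κ.2.2.1 else if i = κ.1 + κ.2.1 + 2 then exitSet t κ.2.2.2
  else {z | z.1 ≤ z.2 ∧ z.2 ≤ t}

/-- The positions of an exit pattern, apart from its centre. -/
def exitPositions (κ : ℕ × ℕ × Bool × Bool) : Finset ℕ :=
  insert 0 (insert (κ.1 + κ.2.1 + 2) ((Finset.Ico 1 (κ.1 + κ.2.1 + 2)).erase (κ.1 + 1)))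

/-- The sequence `a` has the exit pattern `κ` at `v`, with centre of height at most `s`. -/
def IsExitPattern (a : ℕ → ℝ) (s t : ℝ) (κ : ℕ × ℕ × Bool × Bool) (v : ℕ) : Prop :=
  a (v + (κ.1 + 1)) ∈ Set.Iic s ∧
    ∀ i ∈ exitPositions κ, (a (v + (κ.1 + 1)), a (v + i)) ∈ exitStep t κ i

namespace IsExitPattern

variable {a : ℕ → ℝ} {s t : ℝ} {κ κ' : ℕ × ℕ × Bool × Bool} {v v' : ℕ}

lemma left (h : IsExitPattern a s t κ v) : (a (v + (κ.1 + 1)), a v) ∈ exitSet t κ.2.2.1 := by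
  have := h.2 0 (by simp [exitPositions])
  rwa [exitStep, if_pos rfl] at this

lemma right (h : IsExitPattern a s t κ v) :
    (a (v + (κ.1 + 1)), a (v + (κ.1 + κ.2.1 + 2))) ∈ exitSet t κ.2.2.2 := by
  have := h.2 (κ.1 + κ.2.1 + 2) (by simp [exitPositions])
  rwa [exitStep, if_neg (by omega), if_pos rfl] at this

lemma between (h : IsExitPattern a s t κ v) {j : ℕ} (hj : v < j) (hj' : j < v + (κ.1 + κ.2.1 + 2))
    (hne : j ≠ v + (κ.1 + 1)) : a (v + (κ.1 + 1)) ≤ a j ∧ a j ≤ t := by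
  obtain ⟨i, rfl⟩ := Nat.exists_eq_add_of_le hj.le
  have := h.2 i (by
    simp only [exitPositions, Finset.mem_insert, Finset.mem_erase, Finset.mem_Ico]
    omega)
  rwa [exitStep, if_neg (by omega), if_neg (by omega)] at this

lemma not_mem_exitSet {x y : ℝ} {b : Bool} (h : x ≤ y ∧ y ≤ t) : (x, y) ∉ exitSet t b := by
  cases b
  · exact fun h' => not_lt.2 h.1 h'
  · exact fun h' => not_lt.2 h.2 h'

lemma exitSet_unique {x y : ℝ} (hx : x ≤ t) {b b' : Bool} (h : (x, y) ∈ exitSet t b)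
    (h' : (x, y) ∈ exitSet t b') : b = b' := by
  cases b <;> cases b' <;> simp [exitSet] at h h' ⊢ <;> linarith

/-- A vertex is the centre of at most one exit pattern. -/
lemma unique (hst : s ≤ t) (h : IsExitPattern a s t κ v) (h' : IsExitPattern a s t κ' v')
    (hv : v + (κ.1 + 1) = v' + (κ'.1 + 1)) : κ = κ' ∧ v = v' := by
  -- The end points of a pattern lie outside `[x, t]` and its interior inside, so no end point of
  -- one pattern is interior to another with the same centre.
  have key : ∀ {κ κ' : ℕ × ℕ × Bool × Bool} {v v' : ℕ}, IsExitPattern a s t κ v →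
      IsExitPattern a s t κ' v' → v + (κ.1 + 1) = v' + (κ'.1 + 1) →
      v ≤ v' ∧ v' + κ'.1 + κ'.2.1 ≤ v + κ.1 + κ.2.1 := by
    intro κ κ' v v' h h' hv
    constructor
    · by_contra hlt
      have := h'.between (j := v) (by omega) (by omega) (by omega)
      rw [← hv] at this
      exact not_mem_exitSet this h.left
    · by_contra hlt
      have := h'.between (j := v + (κ.1 + κ.2.1 + 2)) (by omega) (by omega) (by omega)
      rw [← hv] at this
      exact not_mem_exitSet this h.right
  obtain ⟨h1, h2⟩ := key h h' hv
  obtain ⟨h3, h4⟩ := key h' h hv.symm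
  obtain rfl : v = v' := le_antisymm h1 h3
  have hk : κ.1 = κ'.1 := by omega
  have hl : κ.2.1 = κ'.2.1 := by omega
  have hx := h.1.trans hst
  have hα := exitSet_unique hx h.left (by rw [hk]; exact h'.left)
  have hβ := exitSet_unique hx h.right (by rw [hk, hl]; exact h'.right)
  exact ⟨Prod.ext hk (Prod.ext hl (Prod.ext hα hβ)), rfl⟩

/-- If both exits are upwards then no lower vertex is reached below level `t`. -/
lemma survives (h : IsExitPattern a s t κ v) (hα : κ.2.2 = (true, true)) {j : ℕ}
    (hj : a j < a (v + (κ.1 + 1))) : ∃ i ∈ Finset.uIcc (v + (κ.1 + 1)) j, t < a i := by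
  have hl := h.left
  have hr := h.right
  rw [hα] at hl hr
  simp only [Finset.mem_uIcc]
  have hne : j ≠ v + (κ.1 + 1) := fun h => by simp [h] at hj
  rcases lt_or_gt_of_ne hne with hlt | hlt
  · refine ⟨v, ?_, hl⟩
    have : ¬ v < j := fun h' => not_lt.2 (h.between h' (by omega) hne).1 hj
    omega
  · refine ⟨v + (κ.1 + κ.2.1 + 2), ?_, hr⟩
    have : ¬ j < v + (κ.1 + κ.2.1 + 2) := fun h' =>
      not_lt.2 (h.between (by omega) h' hne).1 hj
    omega

/-- If one of the exits is downwards then a lower vertex is reached below level `t`. -/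
lemma dies (hst : s ≤ t) (h : IsExitPattern a s t κ v) (hα : κ.2.2 ≠ (true, true)) :
    ∃ j ≤ v + (κ.1 + κ.2.1 + 2), a j < a (v + (κ.1 + 1)) ∧
      ∀ i ∈ Finset.uIcc (v + (κ.1 + 1)) j, a i ≤ t := by
  have hc : a (v + (κ.1 + 1)) ≤ t := h.1.trans hst
  have hb {i : ℕ} (hi : v < i) (hi' : i < v + (κ.1 + κ.2.1 + 2)) : a i ≤ t := by
    by_cases hne : i = v + (κ.1 + 1)
    · rwa [hne]
    · exact (h.between hi hi' hne).2
  simp only [Finset.mem_uIcc]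
  have : κ.2.2.1 = false ∨ κ.2.2.2 = false := by
    by_contra! hcon
    exact hα (Prod.ext (by simpa using hcon.1) (by simpa using hcon.2))
  rcases this with h1 | h1
  · have hl := h.left
    rw [h1] at hl
    have hl : a v < a (v + (κ.1 + 1)) := hl
    refine ⟨v, by omega, hl, fun i hi => ?_⟩
    by_cases hiv : i = v
    · rw [hiv]
      exact hl.le.trans hc
    · exact hb (by omega) (by omega)
  · have hr := h.right
    rw [h1] at hr
    have hr : a (v + (κ.1 + κ.2.1 + 2)) < a (v + (κ.1 + 1)) := hr
    refine ⟨v + (κ.1 + κ.2.1 + 2), le_rfl, hr, fun i hi => ?_⟩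
    by_cases hiv : i = v + (κ.1 + κ.2.1 + 2)
    · rw [hiv]
      exact hr.le.trans hc
    · exact hb (by omega) (by omega)

end IsExitPattern

open Classical in
-- A centre determines its pattern, so sending occurrences of all patterns in `F` to their centres
-- is injective and the counts may be added.
lemma sum_card_isExitPattern_le {a : ℕ → ℝ} {s t : ℝ} (hst : s ≤ t)
    (F : Finset (ℕ × ℕ × Bool × Bool)) (n : ℕ) {G : ℕ → Prop} [DecidablePred G]
    (hG : ∀ κ ∈ F, ∀ v, v + (κ.1 + κ.2.1 + 2) < n → IsExitPattern a s t κ v →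
      G (v + (κ.1 + 1))) :
    ∑ κ ∈ F, ((Finset.range (n - (κ.1 + κ.2.1 + 2))).filter (IsExitPattern a s t κ)).card ≤
      ((Finset.range n).filter G).card := by
  rw [← Finset.card_sigma]
  refine Finset.card_le_card_of_injOn (fun x => x.2 + (x.1.1 + 1)) ?_ ?_
  · rintro ⟨κ, v⟩ hx
    simp only [Finset.coe_sigma, Set.mem_sigma_iff, Finset.mem_coe, Finset.mem_filter,
      Finset.mem_range] at hx ⊢
    exact ⟨by omega, hG κ hx.1 v (by omega) hx.2.2⟩
  · rintro ⟨κ, v⟩ hx ⟨κ', v'⟩ hx' h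
    simp only [Finset.coe_sigma, Set.mem_sigma_iff, Finset.mem_coe, Finset.mem_filter] at hx hx'
    obtain ⟨rfl, rfl⟩ := hx.2.2.unique hst hx'.2.2 h
    rfl

/-! ### Frequencies of exit patterns -/

section ExitProbability

variable {μ : Measure ℝ} {s t : ℝ}

lemma measurableSet_exitSet (t : ℝ) (b : Bool) : MeasurableSet (exitSet t b) := by
  cases b
  · exact measurableSet_lt measurable_snd measurable_fst
  · exact measurableSet_lt measurable_const measurable_snd

lemma measurableSet_exitStep (t : ℝ) (κ : ℕ × ℕ × Bool × Bool) (i : ℕ) :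
    MeasurableSet (exitStep t κ i) := by
  rw [exitStep]
  split_ifs
  · exact measurableSet_exitSet t _
  · exact measurableSet_exitSet t _
  · exact (measurableSet_le measurable_fst measurable_snd).inter
      (measurableSet_le measurable_snd measurable_const)

/-- The conditional probability of the exit pattern `κ`, given the height `x` of its centre. -/
def exitWeight (μ : Measure ℝ) (t : ℝ) (κ : ℕ × ℕ × Bool × Bool) (x : ℝ) : ENNReal :=
  ∏ i ∈ exitPositions κ, μ (Prod.mk x ⁻¹' exitStep t κ i)

lemma exitWeight_eq (κ : ℕ × ℕ × Bool × Bool) (x : ℝ) :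
    exitWeight μ t κ x =
      μ (Prod.mk x ⁻¹' exitSet t κ.2.2.1) * μ (Prod.mk x ⁻¹' exitSet t κ.2.2.2) *
        μ (Set.Icc x t) ^ (κ.1 + κ.2.1) := by
  have hIcc : Prod.mk x ⁻¹' {z : ℝ × ℝ | z.1 ≤ z.2 ∧ z.2 ≤ t} = Set.Icc x t := rfl
  rw [exitWeight, exitPositions, Finset.prod_insert (by simp), Finset.prod_insert (by simp), mul_assoc]
  congr 1
  congr 1
  · rw [exitStep, if_neg (by omega), if_pos rfl]
  -- The interior has `k + l + 1` positions, one of which is the centre.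
  · rw [Finset.prod_congr rfl (g := fun _ => μ (Set.Icc x t)), Finset.prod_const,
      Finset.card_erase_of_mem (by rw [Finset.mem_Ico]; omega), Nat.card_Ico]
    · congr 1
    · intro i hi
      simp only [Finset.mem_erase, Finset.mem_Ico] at hi
      rw [exitStep, if_neg (by omega), if_neg (by omega), hIcc]

/-- The sum factors into two equal one-sided geometric series. Setting `w false = 0` keeps only the
upward exits. -/
lemma tsum_exit_weights (w : Bool → ENNReal) (q : ENNReal) :
    ∑' κ : ℕ × ℕ × Bool × Bool, w κ.2.2.1 * w κ.2.2.2 * q ^ (κ.1 + κ.2.1) =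
      ((w true + w false) * (1 - q)⁻¹) ^ 2 := by
  have h1 (k l : ℕ) : ∑' b : Bool × Bool, w b.1 * w b.2 * q ^ (k + l) =
      (w true + w false) ^ 2 * (q ^ k * q ^ l) := by
    rw [tsum_fintype, Fintype.sum_prod_type]
    simp only [Fintype.sum_bool]
    ring
  rw [ENNReal.tsum_prod (f := fun k (y : ℕ × Bool × Bool) =>
    w y.2.1 * w y.2.2 * q ^ (k + y.1))]
  simp_rw [fun k => ENNReal.tsum_prod (f := fun l (b : Bool × Bool) =>
    w b.1 * w b.2 * q ^ (k + l)), h1, ENNReal.tsum_mul_left, ENNReal.tsum_mul_right,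
    ENNReal.tsum_geometric]
  ring

/-- The probability of the exit pattern `κ`. -/
def exitProbability (μ : Measure ℝ) (s t : ℝ) (κ : ℕ × ℕ × Bool × Bool) : ENNReal :=
  ∫⁻ x in Set.Iic s, exitWeight μ t κ x ∂μ

variable [IsProbabilityMeasure μ]

lemma measurable_exitWeight (κ : ℕ × ℕ × Bool × Bool) : Measurable (exitWeight μ t κ) :=
  Finset.measurable_fun_prod _ fun i _ => measurable_measure_prodMk_left (measurableSet_exitStep t κ i)

lemma measure_Ioi_eq (t : ℝ) : μ (Set.Ioi t) = ENNReal.ofReal (1 - cdf μ t) := by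
  rw [← Set.compl_Iic, prob_compl_eq_one_sub measurableSet_Iic, ← ofReal_cdf,
    ENNReal.ofReal_sub _ (cdf_nonneg μ t), ENNReal.ofReal_one]

lemma exit_total {x : ℝ} (hx : x ≤ t) :
    μ (Set.Ioi t) + μ (Set.Iio x) = 1 - μ (Set.Icc x t) := by
  have h1 : μ (Set.Iio x) + μ (Set.Icc x t) = μ (Set.Iic t) := by
    rw [← Set.Iio_union_Icc_eq_Iic hx, measure_union _ measurableSet_Icc]
    rw [Set.disjoint_left]
    intro y hy hy'
    exact not_lt.2 hy'.1 hy
  have h2 : μ (Set.Ioi t) + μ (Set.Iio x) + μ (Set.Icc x t) = 1 := by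
    rw [add_assoc, h1, ← Set.compl_Iic, add_comm, prob_add_prob_compl measurableSet_Iic]
  rw [← h2, ENNReal.add_sub_cancel_right (measure_ne_top _ _)]

variable [NullSingletonClass μ]

/-- No mass escapes to infinitely long walks: almost every centre has `F(x) > 0`, so each step
leaves `[x, t]` with positive probability and the geometric series sum to 1. -/
lemma tsum_exitProbability (hst : s ≤ t) :
    ∑' κ, exitProbability μ s t κ = μ (Set.Iic s) := by
  simp only [exitProbability]
  rw [← lintegral_tsum fun κ => (measurable_exitWeight κ).aemeasurable, ← setLIntegral_one]
  refine setLIntegral_congr_fun_ae measurableSet_Iic ?_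
  filter_upwards [ae_cdf_pos (μ := μ)] with x hx hxs
  simp_rw [exitWeight_eq]
  rw [tsum_exit_weights fun b => μ (Prod.mk x ⁻¹' exitSet t b)]
  have h : μ (Set.Ioi t) + μ (Set.Iio x) = 1 - μ (Set.Icc x t) := exit_total (le_trans hxs hst)
  change ((μ (Set.Ioi t) + μ (Set.Iio x)) * _) ^ 2 = 1
  rw [← h, ENNReal.mul_inv_cancel, one_pow]
  · rw [Ne, add_eq_zero, not_and]
    intro _
    rw [measure_congr Iio_ae_eq_Iic, ← ofReal_cdf]
    exact (ENNReal.ofReal_pos.2 hx).ne'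
  · exact ENNReal.add_ne_top.2 ⟨measure_ne_top _ _, measure_ne_top _ _⟩

/-- Summing the geometric series gives the upward exit probability `(1 - F(t)) / (1 - F(t) + F(x))`
on each side. The factor 3 passes from density per vertex to density per point of the diagram. -/
lemma tsum_exitProbability_up (hst : s ≤ t) :
    3 * ∑' κ : {κ : ℕ × ℕ × Bool × Bool // κ.2.2 = (true, true)}, exitProbability μ s t κ =
      limitMeasure μ (quadrant s t) := by
  rw [limitMeasure_quadrant hst]
  simp only [exitProbability]
  have hl : ∑' κ : {κ : ℕ × ℕ × Bool × Bool // κ.2.2 = (true, true)},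
      ∫⁻ x in Set.Iic s, exitWeight μ t κ x ∂μ = ∫⁻ x in Set.Iic s,
      ∑' κ : {κ : ℕ × ℕ × Bool × Bool // κ.2.2 = (true, true)}, exitWeight μ t κ x ∂μ :=
    (lintegral_tsum fun κ : {κ : ℕ × ℕ × Bool × Bool // κ.2.2 = (true, true)} =>
      (measurable_exitWeight (μ := μ) (t := t) (κ : ℕ × ℕ × Bool × Bool)).aemeasurable).symm
  rw [hl, ← lintegral_const_mul' _ _ (by simp)]
  refine setLIntegral_congr_fun_ae measurableSet_Iic ?_
  filter_upwards [ae_cdf_pos (μ := μ)] with x hx hxs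
  have hsum : ∑' κ : {κ : ℕ × ℕ × Bool × Bool // κ.2.2 = (true, true)},
      exitWeight μ t κ x =
      ∑' κ : ℕ × ℕ × Bool × Bool, (if κ.2.2.1 then μ (Set.Ioi t) else 0) *
        (if κ.2.2.2 then μ (Set.Ioi t) else 0) * μ (Set.Icc x t) ^ (κ.1 + κ.2.1) := by
    refine (tsum_subtype {κ : ℕ × ℕ × Bool × Bool | κ.2.2 = (true, true)} fun κ =>
      exitWeight μ t κ x).trans ?_
    refine tsum_congr fun κ => ?_
    obtain ⟨k, l, α, β⟩ := κ
    cases α <;> cases β <;> simp [exitWeight_eq]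
    rfl
  rw [hsum, tsum_exit_weights fun b => if b then μ (Set.Ioi t) else 0,
    ← exit_total (le_trans hxs hst), measure_congr Iio_ae_eq_Iic, ← ofReal_cdf, measure_Ioi_eq]
  have h1 : 0 ≤ 1 - cdf μ t := sub_nonneg.2 (cdf_le_one μ t)
  rw [← ENNReal.ofReal_add h1 hx.le]
  simp only [if_true, Bool.false_eq_true, if_false, add_zero]
  rw [← ENNReal.ofReal_inv_of_pos (by positivity), ← ENNReal.ofReal_mul h1,
    ← ENNReal.ofReal_pow (by positivity), ENNReal.ofReal_mul (by norm_num), div_eq_mul_inv]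
  norm_num

end ExitProbability

section Counting

variable {Ω : Type*} [MeasurableSpace Ω] {P : Measure Ω} [IsProbabilityMeasure P] {X : ℕ → Ω → ℝ}
  [NullSingletonClass (P.map (X 0))]

open Classical in
/-- The asymptotic density of points of the diagram in a quadrant. -/
lemma ae_tendsto_quadrant_count (hmeas : ∀ i, Measurable (X i)) (hindep : iIndepFun X P)
    (hident : ∀ i, IdentDistrib (X i) (X 0) P P) {s t : ℝ} (hst : s ≤ t) :
    ∀ᵐ ω ∂P, Tendsto (fun n : ℕ => (((Finset.range n).filter fun k => X k ω ≤ s ∧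
      Survives (fun k => X k ω) n t k).card : ℝ) / n) atTop
      (𝓝 ((limitMeasure (P.map (X 0))).real (quadrant s t) / 3)) := by
  have : IsProbabilityMeasure (P.map (X 0)) :=
    Measure.isProbabilityMeasure_map (hmeas 0).aemeasurable
  set μ := P.map (X 0)
  have htot := tsum_exitProbability (μ := μ) hst
  have hne : ∑' κ, exitProbability μ s t κ ≠ ⊤ := htot ▸ measure_ne_top _ _
  have hpat : ∀ κ : ℕ × ℕ × Bool × Bool, ∀ᵐ ω ∂P, Tendsto (fun n : ℕ => (((Finset.range n).filter
      (IsExitPattern (fun k => X k ω) s t κ)).card : ℝ) / n) atTop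
      (𝓝 (exitProbability μ s t κ).toReal) := fun κ =>
    ae_tendsto_pattern_frequency hmeas hindep hident (by
      simp only [exitPositions, Finset.mem_insert, Finset.mem_erase, Finset.mem_Ico]
      omega) measurableSet_Iic
      (measurableSet_exitStep t κ) fun _ _ => Iff.rfl
  have hcount : ∀ᵐ ω ∂P, Tendsto (fun n : ℕ => (((Finset.range n).filter
      fun v => X v ω ≤ s).card : ℝ) / n) atTop (𝓝 (μ (Set.Iic s)).toReal) := by
    have := ae_tendsto_pattern_frequency (c := 0) hmeas hindep hident (Finset.notMem_empty 0)
      (measurableSet_Iic (a := s)) (fun _ => MeasurableSet.univ) (p := fun ω v => X v ω ≤ s)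
      (by simp)
    simpa using this
  filter_upwards [ae_all_iff.2 hpat, hcount] with ω hω hωc
  set a := fun k => X k ω with ha
  -- `Survives` involves all `n` terms. Patterns with two upward exits bound the survivors from
  -- below, the other patterns bound the rest, and together these are the terms of height at most
  -- `s`.
  have hlim := tendsto_of_sum_le (L := fun κ => (exitProbability μ s t κ).toReal)
    (p := fun κ => κ.2.2 = (true, true))
    (f := fun κ n => (((Finset.range (n - (κ.1 + κ.2.1 + 2))).filter
      (IsExitPattern a s t κ)).card : ℝ) / n)
    (A := fun n => (((Finset.range n).filter fun k => a k ≤ s ∧ Survives a n t k).card : ℝ) / n)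
    (B := fun n => (((Finset.range n).filter fun k => a k ≤ s ∧ ¬ Survives a n t k).card : ℝ) / n)
    (C := fun n => (((Finset.range n).filter fun v => a v ≤ s).card : ℝ) / n)
    (ENNReal.summable_toReal hne) (fun κ => tendsto_shift_div (N := fun n =>
      ((Finset.range n).filter (IsExitPattern a s t κ)).card) (hω κ) _) ?_ ?_ ?_ ?_
  · have h3 : ∑' κ : {κ : ℕ × ℕ × Bool × Bool // κ.2.2 = (true, true)},
        (exitProbability μ s t κ).toReal = (limitMeasure μ).real (quadrant s t) / 3 := by
      rw [Measure.real, ← tsum_exitProbability_up hst, ENNReal.toReal_mul, ENNReal.tsum_toReal_eq]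
      · simp
      · exact fun κ => ENNReal.ne_top_of_tsum_ne_top hne κ.1
    rw [← h3]
    exact hlim
  · intro F hF n
    rw [← Finset.sum_div]
    gcongr
    exact_mod_cast sum_card_isExitPattern_le hst F n (G := fun k => a k ≤ s ∧ Survives a n t k)
      fun κ hκ v hv h => ⟨h.1, fun j _ hj => h.survives (hF κ hκ) hj⟩
  · intro F hF n
    rw [← Finset.sum_div]
    gcongr
    refine mod_cast sum_card_isExitPattern_le hst F n (G := fun k => a k ≤ s ∧ ¬ Survives a n t k)
      fun κ hκ v hv h => ⟨h.1, fun hE => ?_⟩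
    obtain ⟨j, hj, hlt, hle⟩ := h.dies hst (hF κ hκ)
    obtain ⟨i, hi, hti⟩ := hE j (by omega) hlt
    exact not_lt.2 (hle i hi) hti
  · intro n
    rw [← add_div, ← Nat.cast_add]
    congr 2
    rw [← Finset.filter_filter, ← Finset.filter_filter, Finset.card_filter_add_card_filter_not]
  · rw [← ENNReal.tsum_toReal_eq fun κ => ENNReal.ne_top_of_tsum_ne_top hne κ, htot]
    exact hωc

open Classical in
/-- The asymptotic density of points of the diagram is `1/3`. -/
lemma ae_tendsto_total_count (hmeas : ∀ i, Measurable (X i)) (hindep : iIndepFun X P)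
    (hident : ∀ i, IdentDistrib (X i) (X 0) P P)
    (hinj : ∀ᵐ ω ∂P, Function.Injective fun k => X k ω) :
    ∀ᵐ ω ∂P, Tendsto (fun n : ℕ => (((Finset.range n).filter fun k =>
      Survives (fun k => X k ω) n (X k ω) k).card : ℝ) / n) atTop
      (𝓝 (1 / 3)) := by
  have : IsProbabilityMeasure (P.map (X 0)) :=
    Measure.isProbabilityMeasure_map (hmeas 0).aemeasurable
  have hpat := ae_tendsto_pattern_frequency (c := 1) (J := {0, 2}) hmeas hindep hident (by simp)
    MeasurableSet.univ (S := fun _ => {z | z.1 < z.2})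
    (fun _ => measurableSet_lt measurable_fst measurable_snd)
    (p := fun ω v => X (v + 1) ω < X v ω ∧ X (v + 1) ω < X (v + 2) ω) (by simp)
  have hval : (∫⁻ x in Set.univ, ∏ i ∈ ({0, 2} : Finset ℕ),
      P.map (X 0) (Prod.mk x ⁻¹' {z : ℝ × ℝ | z.1 < z.2}) ∂(P.map (X 0))).toReal = 1 / 3 := by
    have h1 : 3 * ∫⁻ x in Set.univ, ∏ i ∈ ({0, 2} : Finset ℕ),
        P.map (X 0) (Prod.mk x ⁻¹' {z : ℝ × ℝ | z.1 < z.2}) ∂(P.map (X 0)) = 1 := by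
      rw [← lintegral_three_mul_one_sub_cdf_sq (μ := P.map (X 0)), setLIntegral_univ,
        ← lintegral_const_mul' _ _ (by simp)]
      refine lintegral_congr fun x => ?_
      have h2 : 0 ≤ 1 - cdf (P.map (X 0)) x := sub_nonneg.2 (cdf_le_one _ x)
      have h3 : Prod.mk x ⁻¹' {z : ℝ × ℝ | z.1 < z.2} = Set.Ioi x := rfl
      rw [Finset.prod_const, h3, measure_Ioi_eq, ENNReal.ofReal_mul (by norm_num),
        ENNReal.ofReal_pow h2]
      norm_num
    have h4 := congrArg ENNReal.toReal h1
    rw [ENNReal.toReal_mul] at h4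
    rw [ENNReal.toReal_ofNat, ENNReal.toReal_one] at h4
    linarith
  rw [hval] at hpat
  filter_upwards [hpat, hinj] with ω hω hωi
  set a := fun k => X k ω with ha
  set N : ℕ → ℕ := fun n => ((Finset.range n).filter fun v =>
    a (v + 1) < a v ∧ a (v + 1) < a (v + 2)).card with hN
  set M : ℕ → ℕ := fun n => ((Finset.range n).filter fun k =>
    Survives a n (a k) k).card with hM
  have hlow := tendsto_shift_div (N := N) hω 2
  have hup : Tendsto (fun n : ℕ => (N (n - 2) : ℝ) / n + 2 / n) atTop (𝓝 (1 / 3)) := by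
    simpa using hlow.add (tendsto_const_div_atTop_nhds_zero_nat 2)
  refine tendsto_of_tendsto_of_tendsto_of_le_of_le hlow hup (fun n => ?_) (fun n => ?_)
  · change (N (n - 2) : ℝ) / n ≤ (M n : ℝ) / n
    gcongr
    refine Finset.card_le_card_of_injOn (· + 1) (fun v hv => ?_) (fun v _ w _ h => by simpa using h)
    simp only [Finset.coe_filter, Finset.mem_range, Set.mem_ofPred_eq] at hv ⊢
    obtain ⟨hv, h0, h2⟩ := hv
    refine ⟨by omega, fun j _ hj => ?_⟩
    rcases lt_trichotomy j (v + 1) with h | h | h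
    · exact ⟨v, by rw [Finset.mem_uIcc]; omega, h0⟩
    · rw [h] at hj
      exact absurd hj (lt_irrefl _)
    · exact ⟨v + 2, by rw [Finset.mem_uIcc]; omega, h2⟩
  · change (M n : ℝ) / n ≤ (N (n - 2) : ℝ) / n + 2 / n
    rw [← add_div]
    gcongr
    -- The two end terms lack a neighbour and may give points without being centres of the pattern;
    -- this is the error `2 / n`.
    have hsub : ((Finset.range n).filter fun k => Survives a n (a k) k) ⊆
        insert 0 (insert (n - 1) (((Finset.range (n - 2)).filter fun v =>
          a (v + 1) < a v ∧ a (v + 1) < a (v + 2)).image (· + 1))) := by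
      intro k hk
      simp only [Finset.mem_filter, Finset.mem_range] at hk
      by_cases hk0 : k = 0
      · simp [hk0]
      by_cases hkn : k = n - 1
      · simp [hkn]
      obtain ⟨v, rfl⟩ := Nat.exists_eq_add_of_le' (Nat.one_le_iff_ne_zero.2 hk0)
      -- The path to a lower neighbour contains nothing above `a (v + 1)`, contradicting survival;
      -- ties are excluded by injectivity.
      have hnb : ∀ j < n, j = v ∨ j = v + 2 → a (v + 1) < a j := by
        intro j hj hjv
        by_contra hle
        have hlt : a j < a (v + 1) :=
          lt_of_le_of_ne (not_lt.1 hle) fun h => by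
            have := hωi h
            omega
        obtain ⟨i, hi, hai⟩ := hk.2 j hj hlt
        rw [Finset.mem_uIcc] at hi
        obtain rfl | rfl : i = v + 1 ∨ i = j := by omega
        · exact lt_irrefl _ hai
        · exact lt_asymm hai hlt
      refine Finset.mem_insert_of_mem (Finset.mem_insert_of_mem (Finset.mem_image.2 ⟨v, ?_, rfl⟩))
      simp only [Finset.mem_filter, Finset.mem_range]
      exact ⟨by omega, hnb v (by omega) (Or.inl rfl), hnb (v + 2) (by omega) (Or.inr rfl)⟩
    have hcard := (Finset.card_le_card hsub).trans
      ((Finset.card_insert_le _ _).trans (Nat.succ_le_succ ((Finset.card_insert_le _ _).trans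
        (Nat.succ_le_succ Finset.card_image_le))))
    exact_mod_cast hcard

end Counting

/-! ### Weak convergence -/

instance : SecondCountableTopology BirthDeath :=
  Topology.IsInducing.subtypeVal.secondCountableTopology

instance : TopologicalSpace.MetrizableSpace BirthDeath :=
  Topology.IsEmbedding.subtypeVal.metrizableSpace

/-- The rectangle of the birth-death pairs with birth in `(s', s]` and death in `(t, t']`. -/
def birthDeathRectangle (s' s t t' : EReal) : Set BirthDeath :=
  {p | (s' < p.1.1 ∧ p.1.1 ≤ s) ∧ t < p.1.2 ∧ p.1.2 ≤ t'}

/-- The rectangles with rational corners, or with upper end `∞`. -/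
def rationalRectangles : Set (Set BirthDeath) :=
  {A | ∃ (s' s t : ℚ) (t' : EReal), s ≤ t ∧ (t' = ⊤ ∨ ∃ q : ℚ, t' = ((q : ℝ) : EReal)) ∧
    A = birthDeathRectangle ((s' : ℝ) : EReal) ((s : ℝ) : EReal) ((t : ℝ) : EReal) t'}

/-- Prepares inclusion–exclusion over quadrants; `min` and `max` make it valid for corners in any
order. -/
lemma birthDeathRectangle_eq (s' s t t' : EReal) : birthDeathRectangle s' s t t' =
    quadrant s t \ (quadrant (min s' s) t ∪ quadrant s (max t t')) := by
  ext p
  simp only [birthDeathRectangle, Set.mem_ofPred_eq, Set.mem_sdiff, Set.mem_union, mem_quadrant,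
    le_min_iff, max_lt_iff, not_or, not_and, not_lt]
  constructor
  · rintro ⟨⟨h1, h2⟩, h3, h4⟩
    exact ⟨⟨h2, h3⟩, fun h => absurd h.1 (not_le.2 h1), fun _ _ => h4⟩
  · rintro ⟨⟨h1, h2⟩, h3, h4⟩
    refine ⟨⟨?_, h1⟩, h2, h4 h1 h2⟩
    by_contra h
    exact absurd (h3 ⟨not_lt.1 h, h1⟩) (not_le.2 h2)

lemma measureReal_birthDeathRectangle (ν : Measure BirthDeath) [IsFiniteMeasure ν]
    (s' s t t' : EReal) : ν.real (birthDeathRectangle s' s t t') =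
      ν.real (quadrant s t) - (ν.real (quadrant (min s' s) t) + ν.real (quadrant s (max t t')) -
        ν.real (quadrant (min s' s) (max t t'))) := by
  have hV := measurableSet_quadrant (min s' s) t
  have hW := measurableSet_quadrant s (max t t')
  have h1 := measureReal_union_add_inter (μ := ν) (s := quadrant (min s' s) t) hW
  rw [quadrant_inter, min_eq_left (min_le_right s' s), max_eq_right (le_max_left t t')] at h1
  rw [birthDeathRectangle_eq, measureReal_sdiff _ (hV.union hW)]
  · linarith
  · rintro p (hp | hp)
    · exact ⟨hp.1.trans (min_le_right _ _), hp.2⟩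
    · exact ⟨hp.1, (le_max_left _ _).trans_lt hp.2⟩

lemma measurableSet_birthDeathRectangle (s' s t t' : EReal) :
    MeasurableSet (birthDeathRectangle s' s t t') := by
  rw [birthDeathRectangle_eq]
  exact (measurableSet_quadrant _ _).diff
    ((measurableSet_quadrant _ _).union (measurableSet_quadrant _ _))

lemma coe_rat_max (p q : ℚ) :
    (((max p q : ℚ) : ℝ) : EReal) = max ((p : ℝ) : EReal) ((q : ℝ) : EReal) := by
  rw [Rat.cast_max, EReal.coe_strictMono.monotone.map_max]

lemma coe_rat_min (p q : ℚ) :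
    (((min p q : ℚ) : ℝ) : EReal) = min ((p : ℝ) : EReal) ((q : ℝ) : EReal) := by
  rw [Rat.cast_min, EReal.coe_strictMono.monotone.map_min]

lemma isPiSystem_rationalRectangles : IsPiSystem rationalRectangles := by
  rintro _ ⟨s', s, t, t', hst, ht', rfl⟩ _ ⟨u', u, v, v', huv, hv', rfl⟩ -
  refine ⟨max s' u', min s u, max t v, min t' v', (min_le_left _ _).trans (hst.trans
    (le_max_left _ _)), ?_, ?_⟩
  · rcases ht' with rfl | ⟨q, rfl⟩
    · rwa [min_eq_right le_top]
    · rcases hv' with rfl | ⟨r, rfl⟩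
      · exact Or.inr ⟨q, min_eq_left le_top⟩
      · exact Or.inr ⟨min q r, (coe_rat_min q r).symm⟩
  · rw [coe_rat_max, coe_rat_min, coe_rat_max]
    ext p
    simp only [birthDeathRectangle, Set.mem_inter_iff, Set.mem_ofPred_eq, max_lt_iff, le_min_iff]
    tauto

lemma exists_rationalRectangle_subset {U : Set BirthDeath} (hU : IsOpen U) {p : BirthDeath}
    (hp : p ∈ U) : ∃ A ∈ rationalRectangles, A ∈ 𝓝 p ∧ A ⊆ U := by
  obtain ⟨O, hO, rfl⟩ := isOpen_induced_iff.1 hU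
  obtain ⟨B, hB, D, hD, hBD⟩ := mem_nhds_prod_iff.1 (hO.mem_nhds hp)
  obtain ⟨l, hl, hlB⟩ := exists_Ioc_subset_of_mem_nhds hB ⟨⊥, p.2.1⟩
  obtain ⟨r, hr, hrB⟩ := exists_Ico_subset_of_mem_nhds hB ⟨p.1.2, p.2.2⟩
  obtain ⟨l₂, hl₂, hlD⟩ := exists_Ioc_subset_of_mem_nhds hD ⟨p.1.1, p.2.2⟩
  -- Choosing `s < m < t` ensures `s ≤ t`.
  obtain ⟨m, hm, hm'⟩ := EReal.lt_iff_exists_rat_btwn.1 p.2.2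
  obtain ⟨s', hs', hs''⟩ := EReal.lt_iff_exists_rat_btwn.1 hl
  obtain ⟨s, hs, hs1⟩ := EReal.lt_iff_exists_rat_btwn.1 (lt_min hr hm)
  obtain ⟨t, ht1, ht⟩ := EReal.lt_iff_exists_rat_btwn.1 (max_lt hl₂ hm')
  rw [lt_min_iff] at hs1
  rw [max_lt_iff] at ht1
  obtain ⟨t', ht', hpt, hnhds, hsub⟩ : ∃ t' : EReal,
      (t' = ⊤ ∨ ∃ q : ℚ, t' = ((q : ℝ) : EReal)) ∧ p.1.2 ≤ t' ∧ Set.Iic t' ∈ 𝓝 p.1.2 ∧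
      Set.Icc p.1.2 t' ⊆ D := by
    rcases eq_or_ne p.1.2 ⊤ with htop | htop
    -- A finite upper end would not give a neighbourhood of death `∞`; this is why rectangles may
    -- end at `⊤`.
    · refine ⟨⊤, Or.inl rfl, le_top, by simp, ?_⟩
      rw [htop, Set.Icc_self, Set.singleton_subset_iff, ← htop]
      exact mem_of_mem_nhds hD
    · obtain ⟨r₂, hr₂, hrD⟩ := exists_Ico_subset_of_mem_nhds hD ⟨⊤, lt_top_iff_ne_top.2 htop⟩
      obtain ⟨q, hq, hq'⟩ := EReal.lt_iff_exists_rat_btwn.1 hr₂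
      exact ⟨_, Or.inr ⟨q, rfl⟩, hq.le, Iic_mem_nhds hq,
        fun y hy => hrD ⟨hy.1, hy.2.trans_lt hq'⟩⟩
  refine ⟨_, ⟨s', s, t, t', ?_, ht', rfl⟩, ?_, ?_⟩
  · have := hs1.2.trans ht1.2
    exact_mod_cast this.le
  · have hb : Tendsto (fun p : BirthDeath => p.1.1) (𝓝 p) (𝓝 p.1.1) :=
      (continuous_fst.comp continuous_subtype_val).tendsto p
    have hd : Tendsto (fun p : BirthDeath => p.1.2) (𝓝 p) (𝓝 p.1.2) :=
      (continuous_snd.comp continuous_subtype_val).tendsto p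
    filter_upwards [hb (Ioc_mem_nhds hs'' hs), hd (Ioi_mem_nhds ht), hd hnhds] with q h1 h2 h3
    exact ⟨h1, h2, h3⟩
  · rintro q ⟨⟨h1, h2⟩, h3, h4⟩
    refine hBD ⟨?_, ?_⟩
    · rcases le_total q.1.1 p.1.1 with h | h
      · exact hlB ⟨hs'.trans h1, h⟩
      · exact hrB ⟨h, h2.trans_lt hs1.1⟩
    · rcases le_total q.1.2 p.1.2 with h | h
      · exact hlD ⟨ht1.1.trans h3, h⟩
      · exact hsub ⟨h, h4⟩

/-- Convergence on the rational quadrants implies weak convergence. -/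
lemma tendsto_of_tendsto_quadrant {ν : ℕ → ProbabilityMeasure BirthDeath}
    {ξ : ProbabilityMeasure BirthDeath}
    (h : ∀ s t : ℚ, s ≤ t → Tendsto
      (fun n => (ν n : Measure BirthDeath).real (quadrant ((s : ℝ) : EReal) ((t : ℝ) : EReal)))
      atTop (𝓝 ((ξ : Measure BirthDeath).real (quadrant ((s : ℝ) : EReal) ((t : ℝ) : EReal))))) :
    Tendsto ν atTop (𝓝 ξ) := by
  -- It suffices to have convergence on a π-system that contains, inside every open set, a
  -- neighbourhood of each of its points.
  refine isPiSystem_rationalRectangles.tendsto_probabilityMeasure_of_tendsto_of_mem ?_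
    (fun U hU p hp => exists_rationalRectangle_subset hU hp) ?_
  · rintro _ ⟨s', s, t, t', -, -, rfl⟩
    exact measurableSet_birthDeathRectangle _ _ _ _
  · rintro _ ⟨s', s, t, t', hst, ht', rfl⟩
    rw [← NNReal.tendsto_coe]
    have hmin : min s' s ≤ t := (min_le_right _ _).trans hst
    have key : Tendsto (fun n => (ν n : Measure BirthDeath).real
        (birthDeathRectangle ((s' : ℝ) : EReal) ((s : ℝ) : EReal) ((t : ℝ) : EReal) t'))
        atTop (𝓝 ((ξ : Measure BirthDeath).real
          (birthDeathRectangle ((s' : ℝ) : EReal) ((s : ℝ) : EReal) ((t : ℝ) : EReal) t'))) := by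
      simp only [measureReal_birthDeathRectangle]
      rw [← coe_rat_min]
      have hmax : ∀ u : ℚ, u ≤ t → Tendsto (fun n => (ν n : Measure BirthDeath).real
          (quadrant ((u : ℝ) : EReal) (max ((t : ℝ) : EReal) t'))) atTop
          (𝓝 ((ξ : Measure BirthDeath).real
            (quadrant ((u : ℝ) : EReal) (max ((t : ℝ) : EReal) t')))) := by
        intro u hu
        rcases ht' with rfl | ⟨q, rfl⟩
        · have : quadrant ((u : ℝ) : EReal) (max ((t : ℝ) : EReal) ⊤) = ∅ := by
            ext p
            simp [mem_quadrant]
          rw [this]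
          simp
        · rw [← coe_rat_max]
          exact h u _ (hu.trans (le_max_left _ _))
      exact (h s t hst).sub (((h _ t hmin).add (hmax s hst)).sub (hmax _ hmin))
    exact key

open Classical in
lemma tendsto_normalizedDiagramMeasure {a : ℕ → ℝ} (ha : Function.Injective a)
    {ξ : ProbabilityMeasure BirthDeath}
    (hQ : ∀ s t : ℚ, s ≤ t → Tendsto (fun n : ℕ => (((Finset.range n).filter fun k =>
      a k ≤ s ∧ Survives a n t k).card : ℝ) / n) atTop
      (𝓝 ((ξ : Measure BirthDeath).real (quadrant ((s : ℝ) : EReal) ((t : ℝ) : EReal)) / 3)))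
    (hM : Tendsto (fun n : ℕ => (((Finset.range n).filter fun k =>
      Survives a n (a k) k).card : ℝ) / n) atTop (𝓝 (1 / 3)))
    (g : BoundedContinuousFunction BirthDeath ℝ) :
    Tendsto (fun n => ∫ z, g z ∂(normalizedDiagramMeasure a n)) atTop
      (𝓝 (∫ z, g z ∂(ξ : Measure BirthDeath))) := by
  -- For an empty diagram, as at `n = 0`, the normalization is not a probability measure; the
  -- sequence is started where the count is positive.
  obtain ⟨N, hN⟩ := eventually_atTop.1
    (hM.eventually (lt_mem_nhds (by norm_num : (0 : ℝ) < 1 / 3)))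
  have hprob (n : ℕ) : IsProbabilityMeasure (normalizedDiagramMeasure a (n + N)) := by
    refine ⟨?_⟩
    rw [normalizedDiagramMeasure, Measure.smul_apply, smul_eq_mul, diagramMeasure_univ ha]
    refine ENNReal.inv_mul_cancel ?_ (ENNReal.natCast_ne_top _)
    intro h0
    have := hN (n + N) (by omega)
    rw [Nat.cast_eq_zero] at h0
    rw [h0] at this
    simp at this
  let ν (n : ℕ) : ProbabilityMeasure BirthDeath := ⟨normalizedDiagramMeasure a (n + N), hprob n⟩
  have hν : Tendsto ν atTop (𝓝 ξ) := by
    refine tendsto_of_tendsto_quadrant fun s t hst => ?_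
    have h := ((hQ s t hst).div hM (by norm_num)).comp (tendsto_add_atTop_nat N)
    rw [div_div_div_cancel_right₀ (by norm_num), div_one] at h
    refine h.congr' ?_
    filter_upwards [eventually_gt_atTop 0] with n hn
    change _ = (normalizedDiagramMeasure a (n + N)).real _
    rw [normalizedDiagramMeasure, measureReal_ennreal_smul_apply, Measure.real,
      diagramMeasure_univ ha, diagramMeasure_quadrant ha _ (by exact_mod_cast hst)]
    have hne : ((n + N : ℕ) : ℝ) ≠ 0 := by
      rw [Nat.cast_ne_zero]
      omega
    simp only [Function.comp_apply, Pi.div_apply, ENNReal.toReal_inv, ENNReal.toReal_natCast]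
    rw [div_div_div_cancel_right₀ hne, div_eq_inv_mul]
  have := (ProbabilityMeasure.tendsto_iff_forall_integral_tendsto.1 hν) g
  exact (tendsto_add_atTop_iff_nat N).1 this

/-! ### The theorem -/

section Main

variable {Ω : Type*} [MeasurableSpace Ω] {P : Measure Ω} [IsProbabilityMeasure P] {X : ℕ → Ω → ℝ}
  [NullSingletonClass (P.map (X 0))]

/-- The diagonal is null for the product of an atomless law with itself. -/
lemma ae_injective (hmeas : ∀ i, Measurable (X i)) (hindep : iIndepFun X P)
    (hident : ∀ i, IdentDistrib (X i) (X 0) P P) :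
    ∀ᵐ ω ∂P, Function.Injective fun k => X k ω := by
  have hne : ∀ i j, i ≠ j → ∀ᵐ ω ∂P, X i ω ≠ X j ω := by
    intro i j hij
    have hmap := (hindep.indepFun hij).map_prod_eq_prod_map_map (hmeas i).aemeasurable
      (hmeas j).aemeasurable
    rw [(hident i).map_eq, (hident j).map_eq] at hmap
    have : IsProbabilityMeasure (P.map (X 0)) :=
      Measure.isProbabilityMeasure_map (hmeas 0).aemeasurable
    have hd : ∀ᵐ z ∂((P.map (X 0)).prod (P.map (X 0))), z.1 ≠ z.2 := by
      refine (Measure.ae_prod_iff_ae_ae (p := fun z : ℝ × ℝ => z.1 ≠ z.2)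
        ((measurableSet_eq_fun measurable_fst measurable_snd).compl)).2 (ae_of_all _ fun x => ?_)
      filter_upwards [Measure.ae_ne (P.map (X 0)) x] with y hy using hy.symm
    rw [← hmap] at hd
    exact ae_of_ae_map ((hmeas i).prodMk (hmeas j)).aemeasurable hd
  have : ∀ᵐ ω ∂P, ∀ i j, i ≠ j → X i ω ≠ X j ω := by
    rw [ae_all_iff]
    intro i
    rw [ae_all_iff]
    intro j
    by_cases hij : i = j
    · simp [hij]
    · filter_upwards [hne i j hij] with ω hω _ using hω
  filter_upwards [this] with ω hω i j h
  by_contra hij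
  exact hω i j hij h

lemma isLimitDiagramMeasure_limitMeasure (hmeas : ∀ i, Measurable (X i)) (hindep : iIndepFun X P)
    (hident : ∀ i, IdentDistrib (X i) (X 0) P P) [IsProbabilityMeasure (P.map (X 0))] :
    IsLimitDiagramMeasure P X ⟨limitMeasure (P.map (X 0)), inferInstance⟩ := by
  have hinj := ae_injective hmeas hindep hident
  -- Restricting to rational quadrants leaves countably many exceptional null sets.
  have hQ : ∀ᵐ ω ∂P, ∀ s t : ℚ, s ≤ t → _ := ae_all_iff.2 fun s => ae_all_iff.2 fun t =>
    eventually_imp_distrib_left.2 fun hst : s ≤ t => ae_tendsto_quadrant_count hmeas hindep hident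
      (s := s) (t := t) (by exact_mod_cast hst)
  filter_upwards [hinj, hQ, ae_tendsto_total_count hmeas hindep hident hinj] with ω h1 h2 h3 g
  exact tendsto_normalizedDiagramMeasure (ξ := ⟨limitMeasure (P.map (X 0)), inferInstance⟩) h1 h2 h3 g

lemma IsLimitDiagramMeasure.unique {Ω : Type*} [MeasurableSpace Ω] {P : Measure Ω}
    [IsProbabilityMeasure P] {X : ℕ → Ω → ℝ} {ξ ξ' : ProbabilityMeasure BirthDeath}
    (h : IsLimitDiagramMeasure P X ξ) (h' : IsLimitDiagramMeasure P X ξ') : ξ' = ξ := by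
  obtain ⟨ω, hω, hω'⟩ := (h.and h').exists
  let : MetricSpace BirthDeath := TopologicalSpace.metrizableSpaceMetric BirthDeath
  have h1 : IsProbabilityMeasure (ξ : Measure BirthDeath) := ξ.2
  have h2 : IsProbabilityMeasure (ξ' : Measure BirthDeath) := ξ'.2
  have heq : (ξ' : Measure BirthDeath) = ξ :=
    ext_of_forall_integral_eq_of_IsFiniteMeasure fun g => tendsto_nhds_unique (hω' g) (hω g)
  exact Subtype.ext heq

lemma limitMeasure_real_lifetimeGT (hmeas : Measurable (X 0)) {ℓ : ℝ} (hℓ : 0 ≤ ℓ) :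
    (limitMeasure (P.map (X 0))).real (lifetimeGT ℓ) =
      3 * ∫ ω, ((1 - cdf (P.map (X 0)) (X 0 ω + ℓ)) /
        (1 - cdf (P.map (X 0)) (X 0 ω + ℓ) + cdf (P.map (X 0)) (X 0 ω))) ^ 2 ∂P := by
  have : IsProbabilityMeasure (P.map (X 0)) :=
    Measure.isProbabilityMeasure_map hmeas.aemeasurable
  have hF : Measurable (cdf (P.map (X 0))) := measurable_cdf
  rw [Measure.real, limitMeasure_lifetimeGT hℓ, lintegral_map (by fun_prop) hmeas,
    ← integral_const_mul, integral_eq_lintegral_of_nonneg_ae (ae_of_all _ fun ω => by positivity)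
    (Measurable.aestronglyMeasurable (by fun_prop))]

end Main

/-- For `x ≤ 1 - ℓ` the denominator is constant, `1 - (x + ℓ) + x = 1 - ℓ`, and for larger `x` the
numerator is 0; what remains is a polynomial integral. -/
lemma limitMeasure_uniform_lifetimeGT {μ : Measure ℝ} (hμ : μ = volume.restrict (Set.Icc 0 1))
    {ℓ : ℝ} (hℓ : 0 ≤ ℓ) (hℓ1 : ℓ ≤ 1) : (limitMeasure μ).real (lifetimeGT ℓ) = 1 - ℓ := by
  have hnull : NullSingletonClass μ := by
    rw [hμ]
    infer_instance
  have hprob : IsProbabilityMeasure μ := ⟨by simp [hμ]⟩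
  have hF : ∀ x, 0 ≤ x → x ≤ 1 → cdf μ x = x := by
    intro x h0 h1
    have : Set.Iic x ∩ Set.Icc 0 1 = Set.Icc 0 x := by
      ext y
      simp only [Set.mem_inter_iff, Set.mem_Iic, Set.mem_Icc]
      exact ⟨fun h => ⟨h.2.1, h.1⟩, fun h => ⟨h.2, h.1, h.2.trans h1⟩⟩
    rw [cdf_eq_real, hμ, Measure.real, Measure.restrict_apply measurableSet_Iic, this,
      Real.volume_Icc, sub_zero, ENNReal.toReal_ofReal h0]
  have hF1 : ∀ x, 1 ≤ x → cdf μ x = 1 := fun x hx =>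
    le_antisymm (cdf_le_one μ x) ((hF 1 zero_le_one le_rfl).symm.le.trans (monotone_cdf μ hx))
  have hsplit : Set.Ioc (0 : ℝ) 1 = Set.Ioc 0 (1 - ℓ) ∪ Set.Ioc (1 - ℓ) 1 :=
    (Set.Ioc_union_Ioc_eq_Ioc (by linarith) (by linarith)).symm
  rw [Measure.real, limitMeasure_lifetimeGT hℓ]
  have hres : ∀ f : ℝ → ENNReal, ∫⁻ x, f x ∂μ = ∫⁻ x in Set.Ioc 0 1, f x := fun f => by
    rw [hμ, restrict_Ioc_eq_restrict_Icc]
  rw [hres, hsplit, lintegral_union measurableSet_Ioc (Set.Ioc_disjoint_Ioc_of_le le_rfl)]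
  have h2 : ∫⁻ x in Set.Ioc (1 - ℓ) 1,
      ENNReal.ofReal (3 * ((1 - cdf μ (x + ℓ)) / (1 - cdf μ (x + ℓ) + cdf μ x)) ^ 2) = 0 := by
    refine (setLIntegral_congr_fun measurableSet_Ioc fun x hx => ?_).trans lintegral_zero
    rw [hF1 (x + ℓ) (by linarith [hx.1])]
    simp
  have h1 : ∫⁻ x in Set.Ioc 0 (1 - ℓ),
      ENNReal.ofReal (3 * ((1 - cdf μ (x + ℓ)) / (1 - cdf μ (x + ℓ) + cdf μ x)) ^ 2) =
      ENNReal.ofReal (1 - ℓ) := by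
    -- At `ℓ = 1` the interval is empty; otherwise division by `1 - ℓ` is legitimate.
    rcases hℓ1.eq_or_lt with rfl | hlt
    · simp
    have hne : 1 - ℓ ≠ 0 := by linarith
    rw [setLIntegral_congr_fun (g := fun x => ENNReal.ofReal (3 * ((1 - ℓ - x) / (1 - ℓ)) ^ 2))
      measurableSet_Ioc fun x hx => ?_,
      lintegral_Ioc_ofReal_eq_sub (f := fun x => -((1 - ℓ) * ((1 - ℓ - x) / (1 - ℓ)) ^ 3))
        (by linarith)]
    · simp [hne]
    · intro x _
      have := ((((hasDerivAt_id x).const_sub (1 - ℓ)).div_const (1 - ℓ)).pow 3).const_mul (1 - ℓ)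
      refine this.neg.congr_deriv ?_
      rw [show (3 - 1 : ℕ) = 2 from rfl]
      simp only [id]
      push_cast
      field_simp
    · fun_prop
    · intro x _
      positivity
    · simp only
      rw [hF (x + ℓ) (by linarith [hx.1]) (by linarith [hx.2]), hF x hx.1.le (by linarith [hx.2])]
      congr 4
      · ring
      · ring
  rw [h1, h2, add_zero, ENNReal.toReal_ofReal (by linarith)]

end

theorem mainTheorem10 {Ω : Type*} [MeasurableSpace Ω] (P : Measure Ω) [IsProbabilityMeasure P]
    (X : ℕ → Ω → ℝ) (hmeas : ∀ i, Measurable (X i)) (hindep : iIndepFun X P)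
    (hident : ∀ i, IdentDistrib (X i) (X 0) P P)
    (hdens : HasPDF (X 0) P volume) :
    ∃ ξ₀ : ProbabilityMeasure BirthDeath,
      IsLimitDiagramMeasure P X ξ₀ ∧
      (∀ ξ' : ProbabilityMeasure BirthDeath, IsLimitDiagramMeasure P X ξ' → ξ' = ξ₀) ∧
      (∀ ℓ : ℝ, 0 ≤ ℓ →
        (ξ₀ : Measure BirthDeath).real (lifetimeGT ℓ) =
          3 * ∫ ω, ((1 - cdf (P.map (X 0)) (X 0 ω + ℓ)) /
            (1 - cdf (P.map (X 0)) (X 0 ω + ℓ) + cdf (P.map (X 0)) (X 0 ω))) ^ 2 ∂P) ∧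
      (pdf.IsUniform (X 0) (Set.Icc 0 1) P volume →
        ∀ ℓ : ℝ, 0 ≤ ℓ → ℓ ≤ 1 →
          (ξ₀ : Measure BirthDeath).real (lifetimeGT ℓ) = 1 - ℓ) := by
  have hprob : IsProbabilityMeasure (P.map (X 0)) :=
    Measure.isProbabilityMeasure_map (hmeas 0).aemeasurable
  -- The density enters only through the absence of atoms.
  have hnull : NullSingletonClass (P.map (X 0)) :=
    ⟨fun x => HasPDF.absolutelyContinuous (X := X 0) (μ := volume) (measure_singleton x)⟩
  have hlim := isLimitDiagramMeasure_limitMeasure hmeas hindep hident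
  refine ⟨_, hlim, fun ξ' h => hlim.unique h,
    fun ℓ hℓ => limitMeasure_real_lifetimeGT (hmeas 0) hℓ, fun hu ℓ hℓ hℓ1 => ?_⟩
  refine limitMeasure_uniform_lifetimeGT ?_ hℓ hℓ1
  rw [hu, ProbabilityTheory.cond, Real.volume_Icc]
  simp
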